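/- **Setting.** Let $(\Omega,\mathcal F)$ be a measurable space with a filtration $\mathbb F=(\mathcal F_t)_{t\ge 0}$, $\mathcal F_t\subseteq\mathcal F$, $\mathcal F_0=\{\emptyset,\Omega\}$, and let $S^1,\dots,S^d$ ($d\ge 1$) be real-valued adapted processes all of whose trajectories are continuous on $[0,\infty)$. A *process* is an adapted map $[0,\infty)\times\Omega\to[-\infty,\infty]$; it is *real* if it is real-valued. A sequence $\tau=(\tau_n)_{n\ge0}$ of stopping times $\Omega\to[0,\infty]$ is *proper* if $\tau_0\equiv 0$, $\tau_n\le\tau_{n+1}$, and for each $\omega$ either $\tau_n(\omega)\to+\infty$ or $(\tau_n(\omega))_n$ is eventually constant. A *simple trading strategy* is $G=(c,(\tau_n),(g_n))$ with $c\in\mathbb R$, $(\tau_n)$ proper, and $g_n:\Omega\to\mathbb R$ bounded, $\mathcal F_{\tau_n}$-measurable and equal to $0$ on $\{\tau_n=\infty\}$; put $(G\cdot S)_t=c+\sum_{n\ge1}g_{n-1}(S_{\tau_n\wedge t}-S_{\tau_{n-1}\wedge t})$. *Simple capital processes* are the sums $\sum_{j=1}^d G^j\cdot S^j$ with simple trading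 strategies $G^1,\dots,G^d$. Let $\mathcal C$ be the smallest class of $[0,\infty]$-valued processes that contains all nonnegative simple capital processes, contains $X+Y$ whenever $X\in\mathcal C$, $Y$ is a simple capital process and $X+Y\ge0$, and is closed under $\liminf_n X^n$ of sequences. A set $E\subseteq[0,\infty)\times\Omega$ is *instantly enforceable* (the property $E$ holds *with instant enforcement*, w.i.e.) if there is $X\in\mathcal C$ with $X_0=1$ and $X_t(\omega)=+\infty$ for all $(t,\omega)\notin E$; complements of such sets are *instantly blockable*. It is assumed that for every $t\ge0$ and every instantly blockable $B$ the projection of $B\cap([0,t]\times\Omega)$ onto $\Omega$ belongs to $\mathcal F_t$. The class of *martingales* is the smallest class of processes real w.i.e. that contains all simple capital processes and contains every process $X$, real w.i.e., for which there are martingales $X^n$ with $\lim_n\sup_{s\in[0,t]}|X_s(\omega)-X^n_s(\omega)|=0$ w.i.e. A process $Y$ is *continuous w.i.e.* if the set of $(t,\omega)$ such that $s\mapsto Y_s(\omega)$ is real and continuous at the point $t$ is instantly enforceable. For a martingale $X$ and a proper sequence $\tau$ let $[X]^\tau_t=\sum_{n\ge1}(X_{\tau_n\wedge t}-X_{\tau_{n-1}\wedge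 t})^2$. The sequence $\tau$ is a *fine cover of $X$ with accuracy $\delta>0$ w.i.e.* if there is an instantly enforceable set $E$ such that for each $(t,\omega)\in E$ there are only finitely many $n$ with $\tau_n(\omega)\le t$, and $\sup_{s\in I}X_s(\omega)-\inf_{s\in I}X_s(\omega)\le\delta$ on $I=[\tau_n(\omega)\wedge t,\tau_{n+1}(\omega)\wedge t]$ for every $n\ge 0$. For $M>0$ let $\sigma(X,M)=\inf\{t\ge0:|X_t|\ge M\}$, with $\inf\emptyset=+\infty$. **Proposition (existence of quadratic variation).** Let $X$ be a martingale. There exists a real process $[X]$, continuous w.i.e., such that the following holds. If $(\delta_m)_{m\ge 0}$ is a sequence of positive reals with $\sum_m\delta_m<\infty$ and, for each $m$, $\sigma^m=(\sigma^m_n)_n$ is a proper sequence of stopping times that is a fine cover of $X$ with accuracy $\delta_m$ w.i.e., then for every $M\in(0,\infty)$ the processes $[X]^{\sigma^m}$ converge to $[X]$ locally uniformly on the random interval $[0,\sigma(X,M)]\setminus\{+\infty\}$ w.i.e., that is, $$\sup_{s\in[0,\sigma(X,M)(\omega)\wedge t]}\bigl|[X]^{\sigma^m}_s(\omega)-[X]_s(\omega)\bigr|\longrightarrow0\quad(m\to\infty)$$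 for all $(t,\omega)$ in an instantly enforceable set; and $[X]^{\sigma^m}$ converge to $[X]$ locally uniformly w.i.e., that is, $\sup_{s\in[0,t]}\bigl|[X]^{\sigma^m}_s(\omega)-[X]_s(\omega)\bigr|\to0$ for all $(t,\omega)$ in an instantly enforceable set. -/

import Mathlib

open MeasureTheory Filter Topology
open scoped NNReal ENNReal

noncomputable section

namespace ModelFree

/-- A martingale space with time set `[0, ∞)` and `d` basic continuous martingales: a filtration
`𝓕` on a measurable space `Ω` with trivial initial σ-field, and real adapted processes
`S 0, …, S (d - 1)` all of whose trajectories are continuous. -/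
structure MartingaleSpace (Ω : Type*) [mΩ : MeasurableSpace Ω] (d : ℕ) where
  /-- the filtration -/
  𝓕 : Filtration ℝ≥0 mΩ
  /-- the basic continuous martingales -/
  S : Fin d → ℝ≥0 → Ω → ℝ
  trivial_zero : 𝓕 0 = ⊥
  adapted : ∀ j, Adapted 𝓕 (S j)
  continuous : ∀ j ω, Continuous fun t => S j t ω

/-- Generalized processes: arbitrary maps `[0, ∞) × Ω → [-∞, ∞]`. -/
abbrev GenProcess (Ω : Type*) := ℝ≥0 → Ω → EReal

/-- A real-valued process, seen as an extended-real-valued one. -/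
def toGen {Ω : Type*} (X : ℝ≥0 → Ω → ℝ) : GenProcess Ω := fun t ω => (X t ω : EReal)

variable {Ω : Type*} [mΩ : MeasurableSpace Ω] {d : ℕ}

/-- Proper sequences of stopping times: non-decreasing, starting from `0`, and on each `ω` either
divergent to `+∞` or eventually constant (with a finite or an infinite value). -/
def IsProper (𝓕 : Filtration ℝ≥0 mΩ) (τ : ℕ → Ω → WithTop ℝ≥0) : Prop :=
  (∀ n, IsStoppingTime 𝓕 (τ n)) ∧ (∀ n ω, τ n ω ≤ τ (n + 1) ω) ∧ (∀ ω, τ 0 ω = 0) ∧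
    ∀ ω, (∀ t : ℝ≥0, ∀ᶠ n in atTop, (t : WithTop ℝ≥0) < τ n ω) ∨
      ∃ n, ∀ k, n ≤ k → τ k ω = τ n ω

/-- Simple trading strategies `(c, (τₙ), (gₙ))`. Since `gₙ` vanishes on `{τₙ = ∞}`, it does not
matter here whether the σ-field of `τₙ` is formed inside the whole σ-field of `Ω` or inside
the σ-field generated by the filtration. -/
structure SimpleStrategy (𝓕 : Filtration ℝ≥0 mΩ) where
  /-- the initial capital -/
  c : ℝ
  /-- the trading times -/
  τ : ℕ → Ω → WithTop ℝ≥0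
  /-- the positions -/
  g : ℕ → Ω → ℝ
  proper : IsProper 𝓕 τ
  measurable : ∀ n, Measurable[(proper.1 n).measurableSpace] (g n)
  bounded : ∀ n, ∃ C : ℝ, ∀ ω, |g n ω| ≤ C
  zero_of_top : ∀ n ω, τ n ω = ⊤ → g n ω = 0

/-- The process `G · X`; `stoppedProcess X (τ n) t ω` is `X` at time `τₙ(ω) ∧ t`. Only finitely
many summands are non-zero, because the sequence `τ` is proper. -/
def SimpleStrategy.integral {𝓕 : Filtration ℝ≥0 mΩ} (G : SimpleStrategy 𝓕)
    (X : ℝ≥0 → Ω → ℝ) : ℝ≥0 → Ω → ℝ := fun t ω =>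
  G.c + ∑' n : ℕ,
    G.g n ω * (stoppedProcess X (G.τ (n + 1)) t ω - stoppedProcess X (G.τ n) t ω)

/-- Simple capital processes: finite sums of simple integrals, one for each basic martingale. -/
def IsSimpleCapital (𝔐 : MartingaleSpace Ω d) (Y : ℝ≥0 → Ω → ℝ) : Prop :=
  ∃ G : Fin d → SimpleStrategy 𝔐.𝓕, ∀ t ω, Y t ω = ∑ j, (G j).integral (𝔐.S j) t ω

/-- The class of nonnegative supermartingales: the smallest class that contains the nonnegative
simple capital processes, is closed under adding a simple capital process as long as the sum is
nonnegative, and is closed under pointwise lower limits of sequences. -/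
inductive IsNonnegSupermartingale (𝔐 : MartingaleSpace Ω d) : GenProcess Ω → Prop
  | capital (Y : ℝ≥0 → Ω → ℝ) (hY : IsSimpleCapital 𝔐 Y) (h0 : ∀ t ω, 0 ≤ Y t ω) :
      IsNonnegSupermartingale 𝔐 (toGen Y)
  | add (X : GenProcess Ω) (Y : ℝ≥0 → Ω → ℝ) (hX : IsNonnegSupermartingale 𝔐 X)
      (hY : IsSimpleCapital 𝔐 Y) (h0 : ∀ t ω, 0 ≤ X t ω + toGen Y t ω) :
      IsNonnegSupermartingale 𝔐 (fun t ω => X t ω + toGen Y t ω)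
  | liminf (X : ℕ → GenProcess Ω) (hX : ∀ n, IsNonnegSupermartingale 𝔐 (X n)) :
      IsNonnegSupermartingale 𝔐 (fun t ω => Filter.liminf (fun n => X n t ω) atTop)

/-- `E` holds with instant enforcement (w.i.e.): some nonnegative supermartingale with initial
value `1` equals `+∞` wherever `E` fails. -/
def InstantlyEnforceable (𝔐 : MartingaleSpace Ω d) (E : Set (ℝ≥0 × Ω)) : Prop :=
  ∃ X : GenProcess Ω, IsNonnegSupermartingale 𝔐 X ∧ (∀ ω, X 0 ω = 1) ∧
    ∀ t ω, (t, ω) ∉ E → X t ω = ⊤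

/-- Instantly blockable sets are the complements of the instantly enforceable ones. -/
def InstantlyBlockable (𝔐 : MartingaleSpace Ω d) (B : Set (ℝ≥0 × Ω)) : Prop :=
  InstantlyEnforceable 𝔐 Bᶜ

/-- The standing assumption on the filtration: for every `t` and every instantly blockable set `B`,
the projection of `B ∩ ([0, t] × Ω)` onto `Ω` belongs to `𝓕 t`. -/
def ProjectionAssumption (𝔐 : MartingaleSpace Ω d) : Prop :=
  ∀ (t : ℝ≥0) (B : Set (ℝ≥0 × Ω)), InstantlyBlockable 𝔐 B →
    MeasurableSet[𝔐.𝓕 t] (Prod.snd '' (B ∩ Set.Iic t ×ˢ Set.univ))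

/-- Real w.i.e. -/
def IsRealWIE (𝔐 : MartingaleSpace Ω d) (Y : GenProcess Ω) : Prop :=
  InstantlyEnforceable 𝔐 {p | Y p.1 p.2 ≠ ⊤ ∧ Y p.1 p.2 ≠ ⊥}

/-- Continuous w.i.e.: the set of the `(t, ω)` such that the trajectory `s ↦ Y s ω` on `[0, ∞)` is
real and continuous at the point `t` is instantly enforceable. -/
def IsContinuousWIE (𝔐 : MartingaleSpace Ω d) (Y : GenProcess Ω) : Prop :=
  InstantlyEnforceable 𝔐
    {p | (Y p.1 p.2 ≠ ⊤ ∧ Y p.1 p.2 ≠ ⊥) ∧ ContinuousAt (fun s => Y s p.2) p.1}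

/-- Uniform distance of the trajectories of `Y` and `Z` on `[0, t]`, with values in `[0, ∞]`
(it is `∞` as soon as one of the two takes an infinite value on `[0, t]`). -/
def supDist (Y Z : GenProcess Ω) (t : ℝ≥0) (ω : Ω) : ℝ≥0∞ :=
  ⨆ (s : ℝ≥0) (_ : s ≤ t), (Y s ω - Z s ω).abs

/-- Locally uniform convergence w.i.e. of `Y m` to `Z`. -/
def ConvergesWIE (𝔐 : MartingaleSpace Ω d) (Y : ℕ → GenProcess Ω) (Z : GenProcess Ω) : Prop :=
  InstantlyEnforceable 𝔐 {p | Tendsto (fun m => supDist (Y m) Z p.1 p.2) atTop (𝓝 0)}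

/-- Locally uniform convergence w.i.e. of `Y m` to `Z` on the random interval `[0, σ] \ {+∞}`. -/
def ConvergesWIEOn (𝔐 : MartingaleSpace Ω d) (σ : Ω → WithTop ℝ≥0) (Y : ℕ → GenProcess Ω)
    (Z : GenProcess Ω) : Prop :=
  InstantlyEnforceable 𝔐
    {p | Tendsto (fun m => supDist (Y m) Z (min (p.1 : WithTop ℝ≥0) (σ p.2)).untopA p.2)
      atTop (𝓝 0)}

/-- The class of martingales: the smallest class of (adapted, extended-real-valued) processes that
are real w.i.e. which contains the simple capital processes and is closed under locally uniform
convergence w.i.e. -/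
inductive IsMartingale (𝔐 : MartingaleSpace Ω d) : GenProcess Ω → Prop
  | capital (Y : ℝ≥0 → Ω → ℝ) (hY : IsSimpleCapital 𝔐 Y) : IsMartingale 𝔐 (toGen Y)
  | lim (X : ℕ → GenProcess Ω) (Z : GenProcess Ω) (hX : ∀ n, IsMartingale 𝔐 (X n))
      (hZ : Adapted 𝔐.𝓕 Z) (hreal : IsRealWIE 𝔐 Z) (hlim : ConvergesWIE 𝔐 X Z) :
      IsMartingale 𝔐 Z

/-- The simple quadratic variation of `X` along `τ`: the sum of the squared increments of `X`
between the times `τₙ ∧ t` and `τₙ₊₁ ∧ t` (an increment with an infinite end value counts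
as infinite). -/
def simpleQV (X : GenProcess Ω) (τ : ℕ → Ω → WithTop ℝ≥0) : GenProcess Ω := fun t ω =>
  ((∑' n : ℕ, (stoppedProcess X (τ (n + 1)) t ω - stoppedProcess X (τ n) t ω).abs ^ 2 : ℝ≥0∞) :
    EReal)

/-- `σ(X, M) = inf {t ∈ [0, ∞) : |X_t| ≥ M}`, with `inf ∅ = +∞`. -/
def hitLevel (X : GenProcess Ω) (M : ℝ) : Ω → WithTop ℝ≥0 := fun ω =>
  ⨅ (t : ℝ≥0) (_ : ENNReal.ofReal M ≤ (X t ω).abs), (t : WithTop ℝ≥0)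

/-- `τ` finely covers `X` with accuracy `δ` on the set `E`. -/
def FinelyCoversOn (𝓕 : Filtration ℝ≥0 mΩ) (τ : ℕ → Ω → WithTop ℝ≥0) (X : GenProcess Ω) (δ : ℝ)
    (E : Set (ℝ≥0 × Ω)) : Prop :=
  (∀ n, IsStoppingTime 𝓕 (τ n)) ∧ (∀ n ω, τ n ω ≤ τ (n + 1) ω) ∧ (∀ ω, τ 0 ω = 0) ∧
    ∀ t ω, (t, ω) ∈ E →
      {n : ℕ | τ n ω ≤ t}.Finite ∧
      ∀ n : ℕ,
        (⨆ (s : ℝ≥0) (_ : (s : WithTop ℝ≥0) ∈ Set.Icc (min (τ n ω) t) (min (τ (n + 1) ω) t)),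
            X s ω) -
          (⨅ (s : ℝ≥0) (_ : (s : WithTop ℝ≥0) ∈ Set.Icc (min (τ n ω) t) (min (τ (n + 1) ω) t)),
            X s ω) ≤ (δ : EReal)

/-- `τ` finely covers `X` with accuracy `δ` w.i.e. -/
def FinelyCoversWIE (𝔐 : MartingaleSpace Ω d) (τ : ℕ → Ω → WithTop ℝ≥0) (X : GenProcess Ω)
    (δ : ℝ) : Prop :=
  ∃ E : Set (ℝ≥0 × Ω), InstantlyEnforceable 𝔐 E ∧ FinelyCoversOn 𝔐.𝓕 τ X δ E

end ModelFree

end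

/-!
The quadratic variations of a martingale `X` along two fine covers `σ` and `ρ` with accuracies `δ`
and `δ'` differ by a simple integral `K` along the merged times, with positions `2 (X_ρ - X_σ)`,
where `X_σ` and `X_ρ` are the values of `X` at the last times of `σ` and `ρ`. These positions are
bounded by `2 η`, `η = δ + δ'`. As long as `|X| ≤ M`, another simple integral `Z`, which starts from
`4 η² (M² + 1)`, dominates `K² + 4 η²` (`exists_ge_of_sq_ge`), so that a bet with
initial capital of order `η²` yields `η` as soon as `K² ≥ η`. If the accuracies are summable, the
Borel–Cantelli lemma `InstantlyEnforceable.eventually_lt` shows that `K² ≥ η` happens only finitely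
often w.i.e. (`IsMartingale.eventually_qvPath_sub_sq_lt`). Along a fixed sequence of covers with
geometrically decreasing accuracies the quadratic variations therefore converge uniformly on
`[0, t]` w.i.e., and along all other sequences they converge to the same limit.

Martingales enter through two facts, proved by induction over their inductive class.
Their trajectories are real and continuous on `[0, t]` w.i.e. (`IsMartingale.isRegularUpTo`), and
simple integrals with respect to them can be hedged by nonnegative supermartingales
(`IsMartingale.exists_superhedge`). For the latter, a simple integral of a simple capital
process is stopped before it becomes negative, and the trades are added one at a time.

Two points of measurability need care. Martingales are only adapted, and continuous only w.i.e., so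
their values at stopping times are taken from the progressively measurable process `leftVersion`.
The limit is continuous on `[0, t]` w.i.e., but it need not be right-continuous at `t` if
convergence fails right after `t`. It is frozen when convergence fails (`frozen`), and the result is adapted by
the assumption on projections (`measurableSet_section`).
-/

noncomputable section

namespace ModelFree

variable {Ω : Type*} [mΩ : MeasurableSpace Ω] {d : ℕ}

/-! ### Nonnegative supermartingales and instant enforcement -/

/-- The strategy that never trades. -/
def SimpleStrategy.const (𝓕 : Filtration ℝ≥0 mΩ) (c : ℝ) : SimpleStrategy 𝓕 where
  c := c
  τ := fun _ _ => 0
  g := fun _ _ => 0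
  proper := ⟨fun _ => isStoppingTime_const 𝓕 0, fun _ _ => le_rfl, fun _ => rfl,
    fun _ => Or.inr ⟨0, fun _ _ => rfl⟩⟩
  measurable := fun _ => measurable_const
  bounded := fun _ => ⟨0, fun _ => by simp⟩
  zero_of_top := fun _ _ _ => rfl

/-- A strategy with capital and positions multiplied by a constant. -/
def SimpleStrategy.smul {𝓕 : Filtration ℝ≥0 mΩ} (a : ℝ) (G : SimpleStrategy 𝓕) :
    SimpleStrategy 𝓕 where
  c := a * G.c
  τ := G.τ
  g := fun n ω => a * G.g n ω
  proper := G.proper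
  measurable := fun n => (G.measurable n).const_mul a
  bounded := fun n => by
    obtain ⟨C, hC⟩ := G.bounded n
    refine ⟨|a| * C, fun ω => ?_⟩
    rw [abs_mul]
    exact mul_le_mul_of_nonneg_left (hC ω) (abs_nonneg a)
  zero_of_top := fun n ω h => by simp [G.zero_of_top n ω h]

lemma isSimpleCapital_const (hd : 1 ≤ d) (𝔐 : MartingaleSpace Ω d) (c : ℝ) :
    IsSimpleCapital 𝔐 (fun _ _ => c) := by
  refine ⟨fun j => SimpleStrategy.const 𝔐.𝓕 (if j = ⟨0, hd⟩ then c else 0), fun t ω => ?_⟩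
  simp [SimpleStrategy.integral, SimpleStrategy.const]

lemma IsSimpleCapital.const_mul {𝔐 : MartingaleSpace Ω d} {Y : ℝ≥0 → Ω → ℝ}
    (hY : IsSimpleCapital 𝔐 Y) (a : ℝ) : IsSimpleCapital 𝔐 (fun t ω => a * Y t ω) := by
  obtain ⟨G, hG⟩ := hY
  refine ⟨fun j => (G j).smul a, fun t ω => ?_⟩
  simp only [hG, Finset.mul_sum]
  refine Finset.sum_congr rfl fun j _ => ?_
  simp [SimpleStrategy.integral, SimpleStrategy.smul, mul_add, mul_assoc, tsum_mul_left]

lemma liminf_add_const_of_nonneg {u : ℕ → EReal} (hu : ∀ n, 0 ≤ u n) {c : EReal} (hc : 0 ≤ c) :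
    liminf (fun n => u n + c) atTop = liminf u atTop + c := by
  have hl : 0 ≤ liminf u atTop :=
    le_liminf_of_le (by isBoundedDefault) (Eventually.of_forall hu)
  induction c with
  | bot => simp at hc
  | top =>
    have h1 : ∀ n, u n + ⊤ = ⊤ := fun n =>
      EReal.add_top_of_ne_bot (fun h => by simpa [h] using hu n)
    rw [EReal.add_top_of_ne_bot (fun h => by simp [h] at hl)]
    simp [h1]
  | coe r =>
    have hm : Monotone (fun x : EReal => x + (r : EReal)) := fun x y h => add_le_add_left h _
    refine (hm.map_liminf_of_continuousAt u ?_ (by isBoundedDefault) (by isBoundedDefault)).symm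
    have := EReal.continuousAt_add (p := (liminf u atTop, (r : EReal))) (by simp) (by simp)
    exact this.comp (f := fun x : EReal => (x, (r : EReal))) (by fun_prop)

lemma tendsto_sum_of_frequently {u : ℕ → EReal} (hu : ∀ n, 0 ≤ u n) (h : ∃ᶠ n in atTop, 1 ≤ u n) :
    Tendsto (fun N => ∑ m ∈ Finset.range N, u m) atTop (𝓝 ⊤) := by
  have hmono : Monotone fun N => ∑ m ∈ Finset.range N, u m :=
    monotone_nat_of_le_succ fun n => by
      rw [Finset.sum_range_succ]; exact le_add_of_nonneg_right (hu n)
  have hk : ∀ k : ℕ, ∃ N, (k : EReal) ≤ ∑ m ∈ Finset.range N, u m := by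
    intro k
    induction k with
    | zero => exact ⟨0, by simp⟩
    | succ k ih =>
      obtain ⟨N, hN⟩ := ih
      obtain ⟨n, hn, hn'⟩ := (frequently_atTop.1 h) N
      refine ⟨n + 1, ?_⟩
      rw [Finset.sum_range_succ, Nat.cast_succ]
      exact add_le_add (hN.trans (hmono hn)) hn'
  rw [EReal.tendsto_nhds_top_iff_real]
  intro x
  obtain ⟨k, hxk⟩ := exists_nat_gt x
  obtain ⟨N, hN⟩ := hk k
  filter_upwards [eventually_ge_atTop N] with n hn
  refine lt_of_lt_of_le ?_ (hN.trans (hmono hn))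
  exact_mod_cast hxk

namespace IsNonnegSupermartingale

variable {𝔐 : MartingaleSpace Ω d}

lemma nonneg {X : GenProcess Ω} (hX : IsNonnegSupermartingale 𝔐 X) (t : ℝ≥0) (ω : Ω) :
    0 ≤ X t ω := by
  induction hX with
  | capital Y hY h0 => exact EReal.coe_nonneg.2 (h0 t ω)
  | add X Y hX hY h0 _ => exact h0 t ω
  | liminf X hX ih => exact le_liminf_of_le (by isBoundedDefault) (Eventually.of_forall ih)

lemma const (hd : 1 ≤ d) {c : ℝ} (hc : 0 ≤ c) :
    IsNonnegSupermartingale 𝔐 (fun _ _ => (c : EReal)) :=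
  .capital _ (isSimpleCapital_const hd 𝔐 c) fun _ _ => hc

lemma const_mul {X : GenProcess Ω} (hX : IsNonnegSupermartingale 𝔐 X) {a : ℝ} (ha : 0 < a) :
    IsNonnegSupermartingale 𝔐 (fun t ω => (a : EReal) * X t ω) := by
  induction hX with
  | capital Y hY h0 =>
    exact .capital _ (hY.const_mul a) fun t ω => mul_nonneg ha.le (h0 t ω)
  | add X Y hX hY h0 ih =>
    have key : ∀ t ω, (a : EReal) * (X t ω + toGen Y t ω)
        = a * X t ω + toGen (fun t ω => a * Y t ω) t ω := by
      intro t ω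
      rw [EReal.left_distrib_of_nonneg_of_ne_top (by exact_mod_cast ha.le)
        (EReal.coe_ne_top a)]
      simp [toGen]
    simp only [key]
    refine .add _ _ ih (hY.const_mul a) fun t ω => ?_
    rw [← key]
    exact mul_nonneg (by exact_mod_cast ha.le) (h0 t ω)
  | liminf X hX ih =>
    have key : ∀ t ω, (a : EReal) * Filter.liminf (fun n => X n t ω) atTop
        = Filter.liminf (fun n => (a : EReal) * X n t ω) atTop := by
      intro t ω
      exact (EReal.liminf_const_mul_of_nonneg_of_ne_top (by exact_mod_cast ha.le)
        (EReal.coe_ne_top a)).symm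
    simp only [key]
    exact .liminf _ ih

lemma add_supermartingale {X X' : GenProcess Ω} (hX : IsNonnegSupermartingale 𝔐 X)
    (hX' : IsNonnegSupermartingale 𝔐 X') :
    IsNonnegSupermartingale 𝔐 (fun t ω => X t ω + X' t ω) := by
  induction hX with
  | capital Y hY h0 =>
    have := IsNonnegSupermartingale.add X' Y hX' hY fun t ω =>
      add_nonneg (hX'.nonneg t ω) (EReal.coe_nonneg.2 (h0 t ω))
    simpa only [add_comm] using this
  | add X Y hX hY h0 ih =>
    have key : ∀ t ω, X t ω + toGen Y t ω + X' t ω = X t ω + X' t ω + toGen Y t ω :=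
      fun t ω => add_right_comm _ _ _
    simp only [key]
    refine .add _ Y ih hY fun t ω => ?_
    rw [← key]
    exact add_nonneg (h0 t ω) (hX'.nonneg t ω)
  | liminf X hX ih =>
    have key : ∀ t ω, Filter.liminf (fun n => X n t ω) atTop + X' t ω
        = Filter.liminf (fun n => X n t ω + X' t ω) atTop := fun t ω =>
      (liminf_add_const_of_nonneg (fun n => (hX n).nonneg t ω) (hX'.nonneg t ω)).symm
    simp only [key]
    exact .liminf _ ih

lemma finset_sum (hd : 1 ≤ d) {Y : ℕ → GenProcess Ω} (hY : ∀ m, IsNonnegSupermartingale 𝔐 (Y m))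
    (N : ℕ) : IsNonnegSupermartingale 𝔐 (fun t ω => ∑ m ∈ Finset.range N, Y m t ω) := by
  induction N with
  | zero => simpa using IsNonnegSupermartingale.const (𝔐 := 𝔐) hd le_rfl
  | succ N ih =>
    simp only [Finset.sum_range_succ]
    exact ih.add_supermartingale (hY N)

end IsNonnegSupermartingale

namespace InstantlyEnforceable

variable {𝔐 : MartingaleSpace Ω d}

lemma mono {E F : Set (ℝ≥0 × Ω)} (hE : InstantlyEnforceable 𝔐 E) (h : E ⊆ F) :
    InstantlyEnforceable 𝔐 F := by
  obtain ⟨X, h1, h2, h3⟩ := hE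
  exact ⟨X, h1, h2, fun t ω hp => h3 t ω fun h' => hp (h h')⟩

lemma univ (hd : 1 ≤ d) (𝔐 : MartingaleSpace Ω d) : InstantlyEnforceable 𝔐 Set.univ :=
  ⟨_, .const hd zero_le_one, fun _ => rfl, fun _ _ h => (h trivial).elim⟩

/-- Countably many nonnegative supermartingales with summable initial capitals enforce every
property outside of which their total capital is infinite. -/
lemma of_tendsto_sum (hd : 1 ≤ d) {Y : ℕ → GenProcess Ω}
    (hY : ∀ m, IsNonnegSupermartingale 𝔐 (Y m)) {c : ℕ → ℝ} (hc : ∀ m, 0 < c m)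
    (hs : Summable c) (h0 : ∀ m ω, Y m 0 ω = c m) {E : Set (ℝ≥0 × Ω)}
    (hE : ∀ t ω, (t, ω) ∉ E →
      Tendsto (fun N => ∑ m ∈ Finset.range N, Y m t ω) atTop (𝓝 ⊤)) :
    InstantlyEnforceable 𝔐 E := by
  have hw : 0 < ∑' m, c m := hs.tsum_pos (fun m => (hc m).le) 0 (hc 0)
  have hW := (IsNonnegSupermartingale.liminf _
    (IsNonnegSupermartingale.finset_sum hd hY)).const_mul (inv_pos.2 hw)
  refine ⟨_, hW, fun ω => ?_, fun t ω h => ?_⟩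
  · have h1 : Tendsto (fun N => ∑ m ∈ Finset.range N, Y m 0 ω) atTop
        (𝓝 ((∑' m, c m : ℝ) : EReal)) := by
      have h2 : ∀ N, ∑ m ∈ Finset.range N, Y m 0 ω = ((∑ m ∈ Finset.range N, c m : ℝ) : EReal) := by
        intro N
        simp only [h0]
        induction N with
        | zero => simp
        | succ N ih => rw [Finset.sum_range_succ, Finset.sum_range_succ, ih]; norm_cast
      simp only [h2]
      exact (continuous_coe_real_ereal.tendsto _).comp hs.hasSum.tendsto_sum_nat
    rw [h1.liminf_eq, ← EReal.coe_mul, inv_mul_cancel₀ hw.ne', EReal.coe_one]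
  · rw [(hE t ω h).liminf_eq]
    exact EReal.coe_mul_top_of_pos (inv_pos.2 hw)

lemma iInter (hd : 1 ≤ d) {E : ℕ → Set (ℝ≥0 × Ω)} (hE : ∀ n, InstantlyEnforceable 𝔐 (E n)) :
    InstantlyEnforceable 𝔐 (⋂ n, E n) := by
  choose V hV h0 hV' using hE
  refine of_tendsto_sum hd (Y := fun n t ω => ((1 / 2 : ℝ) ^ n : ℝ) * V n t ω)
    (fun m => (hV m).const_mul (by positivity)) (c := fun n => (1 / 2 : ℝ) ^ n)
    (fun m => by positivity) summable_geometric_two (fun m ω => by simp [h0]) ?_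
  intro t ω h
  simp only [Set.mem_iInter, not_forall] at h
  obtain ⟨n, hn⟩ := h
  have hpos : ∀ m, (0 : EReal) ≤ ((1 / 2 : ℝ) ^ m : ℝ) * V m t ω := fun m =>
    ((hV m).const_mul (by positivity)).nonneg t ω
  refine tendsto_const_nhds.congr' ?_
  filter_upwards [eventually_gt_atTop n] with N hN
  symm
  rw [eq_top_iff]
  calc (⊤ : EReal) = ((1 / 2 : ℝ) ^ n : ℝ) * V n t ω := by
        rw [hV' n t ω hn, EReal.coe_mul_top_of_pos (by positivity)]
    _ ≤ _ := Finset.single_le_sum (f := fun m => (((1 / 2 : ℝ) ^ m : ℝ) : EReal) * V m t ω)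
        (fun i _ => hpos i) (Finset.mem_range.2 hN)

lemma inter (hd : 1 ≤ d) {E F : Set (ℝ≥0 × Ω)} (hE : InstantlyEnforceable 𝔐 E)
    (hF : InstantlyEnforceable 𝔐 F) : InstantlyEnforceable 𝔐 (E ∩ F) := by
  refine (iInter hd (E := fun n => if n = 0 then E else F) fun n => ?_).mono ?_
  · split_ifs
    exacts [hE, hF]
  · intro p hp
    simp only [Set.mem_iInter] at hp
    exact ⟨by simpa using hp 0, by simpa using hp 1⟩

/-- A Borel–Cantelli lemma: only finitely many of the supermartingales `Y m` exceed the levels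
`b m` if the ratios of the initial capitals `c m` to the levels are summable. -/
lemma eventually_lt (hd : 1 ≤ d) {Y : ℕ → GenProcess Ω}
    (hY : ∀ m, IsNonnegSupermartingale 𝔐 (Y m)) {c b : ℕ → ℝ} (hc : ∀ m, 0 < c m)
    (hb : ∀ m, 0 < b m) (hs : Summable fun m => c m / b m) (h0 : ∀ m ω, Y m 0 ω = c m) :
    InstantlyEnforceable 𝔐 {p | ∀ᶠ m in atTop, Y m p.1 p.2 < b m} := by
  refine of_tendsto_sum hd (Y := fun m t ω => (((b m)⁻¹ : ℝ) : EReal) * Y m t ω)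
    (fun m => (hY m).const_mul (inv_pos.2 (hb m))) (fun m => div_pos (hc m) (hb m)) hs
    (fun m ω => ?_) fun t ω h => ?_
  · rw [h0, ← EReal.coe_mul, div_eq_inv_mul]
  · refine tendsto_sum_of_frequently
      (fun m => ((hY m).const_mul (inv_pos.2 (hb m))).nonneg t ω) ?_
    simp only [Set.mem_ofPred_eq, not_eventually, not_lt] at h
    refine h.mono fun m hm => ?_
    have hb' : (0 : EReal) ≤ (((b m)⁻¹ : ℝ) : EReal) := by exact_mod_cast (inv_pos.2 (hb m)).le
    calc (1 : EReal) = (((b m)⁻¹ : ℝ) : EReal) * (b m : EReal) := by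
          rw [← EReal.coe_mul, inv_mul_cancel₀ (hb m).ne', EReal.coe_one]
      _ ≤ _ := mul_le_mul_of_nonneg_left hm hb'

end InstantlyEnforceable

/-! ### Times cut off by a deterministic time -/

/-- The time `a ∧ t`. The value of `stoppedProcess X τ` at `t` is that of `X` at `cut (τ ω) t`. -/
def cut (a : WithTop ℝ≥0) (t : ℝ≥0) : ℝ≥0 := (min (t : WithTop ℝ≥0) a).untopA

lemma coe_cut (a : WithTop ℝ≥0) (t : ℝ≥0) : (cut a t : WithTop ℝ≥0) = min (t : WithTop ℝ≥0) a := by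
  rw [cut, WithTop.untopA_eq_untop, WithTop.coe_untop]
  exact ne_top_of_le_ne_top WithTop.coe_ne_top (min_le_left _ _)

lemma cut_le (a : WithTop ℝ≥0) (t : ℝ≥0) : cut a t ≤ t := by
  rw [← WithTop.coe_le_coe, coe_cut]; exact min_le_left _ _

lemma coe_cut_le (a : WithTop ℝ≥0) (t : ℝ≥0) : (cut a t : WithTop ℝ≥0) ≤ a := by
  rw [coe_cut]; exact min_le_right _ _

lemma cut_of_le {a : WithTop ℝ≥0} {t : ℝ≥0} (h : (t : WithTop ℝ≥0) ≤ a) : cut a t = t := by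
  rw [← WithTop.coe_inj, coe_cut, min_eq_left h]

lemma coe_cut_of_ge {a : WithTop ℝ≥0} {t : ℝ≥0} (h : a ≤ (t : WithTop ℝ≥0)) :
    (cut a t : WithTop ℝ≥0) = a := by
  rw [coe_cut, min_eq_right h]

@[simp] lemma cut_zero_right (a : WithTop ℝ≥0) : cut a 0 = 0 := le_antisymm (cut_le a 0) bot_le

lemma cut_cut (a b : WithTop ℝ≥0) (t : ℝ≥0) : cut a (cut b t) = cut (min a b) t := by
  rw [← WithTop.coe_inj, coe_cut, coe_cut, coe_cut, min_assoc, min_comm a b]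

lemma cut_comm (a b : WithTop ℝ≥0) (t : ℝ≥0) : cut a (cut b t) = cut b (cut a t) := by
  rw [cut_cut, cut_cut, min_comm]

lemma continuous_cut (a : WithTop ℝ≥0) : Continuous (cut a) := by
  induction a with
  | top =>
    have : cut ⊤ = id := funext fun t => cut_of_le le_top
    rw [this]; exact continuous_id
  | coe r =>
    have : cut (r : WithTop ℝ≥0) = fun t => min t r := funext fun t => by
      rw [← WithTop.coe_inj, coe_cut]; rfl
    rw [this]; fun_prop

lemma apply_cut_min_max {f : ℝ≥0 → ℝ} {a α β : WithTop ℝ≥0} (h : α ≤ β) (t : ℝ≥0) :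
    f (cut (min (max a α) β) t) =
      f (cut a (cut β t)) - f (cut a (cut α t)) + f (cut α t) := by
  simp only [cut_cut]
  rcases le_total a α with h1 | h1
  · rw [max_eq_right h1, min_eq_left h, min_eq_left (h1.trans h), min_eq_left h1]; ring
  · rw [max_eq_left h1, min_eq_right h1]; ring

/-! ### Simple integrals -/

lemma IsProper.mono {𝓕 : Filtration ℝ≥0 mΩ} {τ : ℕ → Ω → WithTop ℝ≥0} (hτ : IsProper 𝓕 τ) (ω : Ω) :
    Monotone fun n => τ n ω := monotone_nat_of_le_succ fun n => hτ.2.1 n ω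

lemma IsProper.exists_cut_eq {𝓕 : Filtration ℝ≥0 mΩ} {τ : ℕ → Ω → WithTop ℝ≥0}
    (hτ : IsProper 𝓕 τ) (t : ℝ≥0) (ω : Ω) :
    ∃ N, ∀ n, N ≤ n → ∀ s, s ≤ t → cut (τ (n + 1) ω) s = cut (τ n ω) s := by
  rcases hτ.2.2.2 ω with h | ⟨N, hN⟩
  · obtain ⟨N, hN⟩ := eventually_atTop.1 (h t)
    refine ⟨N, fun n hn s hs => ?_⟩
    have hs' : (s : WithTop ℝ≥0) ≤ t := by exact_mod_cast hs
    rw [cut_of_le (hs'.trans (hN n hn).le), cut_of_le (hs'.trans (hN _ (by omega)).le)]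
  · exact ⟨N, fun n hn s _ => by rw [hN n hn, hN (n + 1) (by omega)]⟩

namespace SimpleStrategy

variable {𝓕 : Filtration ℝ≥0 mΩ}

/-- The capital from the first `N` trades of a simple strategy. -/
def partialSum (G : SimpleStrategy 𝓕) (X : ℝ≥0 → Ω → ℝ) (N : ℕ) (t : ℝ≥0) (ω : Ω) : ℝ :=
  G.c + ∑ n ∈ Finset.range N,
    G.g n ω * (X (cut (G.τ (n + 1) ω) t) ω - X (cut (G.τ n ω) t) ω)

lemma exists_integral_eq (G : SimpleStrategy 𝓕) (t : ℝ≥0) (ω : Ω) :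
    ∃ N₀, ∀ N, N₀ ≤ N → ∀ s, s ≤ t → ∀ X : ℝ≥0 → Ω → ℝ,
      G.integral X s ω = G.partialSum X N s ω := by
  obtain ⟨N₀, h⟩ := G.proper.exists_cut_eq t ω
  refine ⟨N₀, fun N hN s hs X => ?_⟩
  rw [integral, partialSum, tsum_eq_sum (s := Finset.range N)]
  · rfl
  · intro n hn
    have h1 := h n (by simp at hn; omega) s hs
    simp only [stoppedProcess]
    rw [← cut, ← cut, h1, sub_self, mul_zero]

lemma integral_cut (G : SimpleStrategy 𝓕) (X : ℝ≥0 → Ω → ℝ) (N : ℕ) (t : ℝ≥0) (ω : Ω) :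
    G.integral X (cut (G.τ N ω) t) ω = G.partialSum X N t ω := by
  rw [integral, partialSum, tsum_eq_sum (s := Finset.range N)]
  · congr 1
    refine Finset.sum_congr rfl fun n hn => ?_
    have hn' : n + 1 ≤ N := Finset.mem_range.1 hn
    simp only [stoppedProcess]
    rw [← cut, ← cut, cut_cut, cut_cut, min_eq_left (G.proper.mono ω hn'),
      min_eq_left (G.proper.mono ω (by omega : n ≤ N))]
  · intro n hn
    have hn' : N ≤ n := by simpa using hn
    simp only [stoppedProcess]
    rw [← cut, ← cut, cut_cut, cut_cut, min_eq_right (G.proper.mono ω hn'),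
      min_eq_right (G.proper.mono ω (by omega : N ≤ n + 1)), sub_self, mul_zero]

@[simp] lemma integral_zero (G : SimpleStrategy 𝓕) (X : ℝ≥0 → Ω → ℝ) (ω : Ω) :
    G.integral X 0 ω = G.c := by
  obtain ⟨N, h⟩ := G.exists_integral_eq 0 ω
  simp [h N le_rfl 0 le_rfl X, partialSum]

lemma continuous_integral (G : SimpleStrategy 𝓕) {X : ℝ≥0 → Ω → ℝ} {ω : Ω}
    (hX : Continuous fun t => X t ω) : Continuous fun t => G.integral X t ω := by
  rw [continuous_iff_continuousAt]
  intro t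
  obtain ⟨N, h⟩ := G.exists_integral_eq (t + 1) ω
  have hc : Continuous fun s => G.partialSum X N s ω := by
    refine continuous_const.add (continuous_finsetSum _ fun n _ => continuous_const.mul ?_)
    exact (hX.comp (continuous_cut _)).sub (hX.comp (continuous_cut _))
  refine hc.continuousAt.congr ?_
  filter_upwards [Iio_mem_nhds (lt_add_one t)] with s hs
  exact (h N le_rfl s (le_of_lt hs) X).symm

end SimpleStrategy

lemma measurable_indicator_le_const {𝓕 : Filtration ℝ≥0 mΩ} {τ : Ω → WithTop ℝ≥0}
    (hτ : IsStoppingTime 𝓕 τ) {g : Ω → ℝ} (hg : Measurable[hτ.measurableSpace] g) (t : ℝ≥0) :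
    Measurable[𝓕 t] ({ω | τ ω ≤ t}.indicator g) := by
  intro B hB
  rw [Set.indicator_preimage, Set.ite]
  refine MeasurableSet.union ?_ ?_
  · exact (hg hB).2 t
  · exact (measurable_const hB).diff (hτ t)

lemma measurable_indicator_le_stopping {𝓕 : Filtration ℝ≥0 mΩ} {τ π : Ω → WithTop ℝ≥0}
    (hτ : IsStoppingTime 𝓕 τ) (hπ : IsStoppingTime 𝓕 π) {g : Ω → ℝ}
    (hg : Measurable[hτ.measurableSpace] g) :
    Measurable[(hτ.min hπ).measurableSpace] ({ω | τ ω ≤ π ω}.indicator g) := by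
  intro B hB
  rw [Set.indicator_preimage, Set.ite]
  refine MeasurableSet.union ?_ ?_
  · exact hτ.measurableSet_inter_le hπ _ (hg hB)
  · exact (measurable_const hB).diff (hτ.measurableSet_stopping_time_le_min hπ)

lemma measurable_apply_cut {𝓕 : Filtration ℝ≥0 mΩ} {X : ℝ≥0 → Ω → ℝ} (hX : Adapted 𝓕 X)
    (hc : ∀ ω, Continuous fun t => X t ω) {τ : Ω → WithTop ℝ≥0} (hτ : IsStoppingTime 𝓕 τ)
    (t : ℝ≥0) : Measurable[𝓕 t] fun ω => X (cut (τ ω) t) ω := by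
  have hprog := hX.stronglyAdapted.isStronglyProgressive_of_continuous hc
  exact (hprog.stronglyAdapted_stoppedProcess hτ t).measurable

lemma SimpleStrategy.adapted_integral {𝓕 : Filtration ℝ≥0 mΩ} (G : SimpleStrategy 𝓕)
    {X : ℝ≥0 → Ω → ℝ} (hX : Adapted 𝓕 X) (hc : ∀ ω, Continuous fun t => X t ω) :
    Adapted 𝓕 (G.integral X) := by
  intro t
  have hN : ∀ N, Measurable[𝓕 t] (fun ω => G.partialSum X N t ω) := by
    intro N
    refine Measurable.const_add (Finset.measurable_sum _ fun n _ => ?_) _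
    have h1 := measurable_indicator_le_const (G.proper.1 n) (G.measurable n) t
    have h2 := (measurable_apply_cut hX hc (G.proper.1 (n + 1)) t).sub
      (measurable_apply_cut hX hc (G.proper.1 n) t)
    convert! h1.mul h2 using 1
    ext ω
    by_cases hω : G.τ n ω ≤ t
    · simp only [Pi.mul_apply, Pi.sub_apply]
      rw [Set.indicator_of_mem (show ω ∈ {ω | G.τ n ω ≤ t} from hω)]
    · have h3 : (t : WithTop ℝ≥0) ≤ G.τ n ω := (not_le.1 hω).le
      simp [cut_of_le h3, cut_of_le (h3.trans (G.proper.2.1 n ω))]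
  refine @measurable_of_tendsto_metrizable Ω ℝ (𝓕 t) _ _ _ _ _ _ hN ?_
  rw [tendsto_pi_nhds]
  intro ω
  obtain ⟨N₀, h⟩ := G.exists_integral_eq t ω
  refine tendsto_const_nhds.congr' ?_
  filter_upwards [eventually_ge_atTop N₀] with N hN
  exact h N hN t le_rfl X

namespace IsSimpleCapital

variable {𝔐 : MartingaleSpace Ω d} {Y : ℝ≥0 → Ω → ℝ}

lemma continuous (hY : IsSimpleCapital 𝔐 Y) (ω : Ω) : Continuous fun t => Y t ω := by
  obtain ⟨G, hG⟩ := hY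
  simp only [hG]
  exact continuous_finsetSum _ fun j _ => (G j).continuous_integral (𝔐.continuous j ω)

lemma adapted (hY : IsSimpleCapital 𝔐 Y) : Adapted 𝔐.𝓕 Y := by
  obtain ⟨G, hG⟩ := hY
  intro t
  have : Y t = fun ω => ∑ j, (G j).integral (𝔐.S j) t ω := funext (hG t)
  rw [this]
  exact Finset.measurable_sum _ fun j _ =>
    (G j).adapted_integral (𝔐.adapted j) (𝔐.continuous j) t

end IsSimpleCapital

/-- The strategy that follows `G`, with positions multiplied by `γ`, between the stopping times
`α ≤ β`. Its trading times are `(τₖ ∨ α) ∧ β`, preceded by the time `0`. -/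
def SimpleStrategy.segment {𝓕 : Filtration ℝ≥0 mΩ} (G : SimpleStrategy 𝓕) {α β : Ω → WithTop ℝ≥0}
    (hα : IsStoppingTime 𝓕 α) (hβ : IsStoppingTime 𝓕 β) {γ : Ω → ℝ}
    (hγ : Measurable[hα.measurableSpace] γ) (hb : ∃ C, ∀ ω, |γ ω| ≤ C)
    (htop : ∀ ω, α ω = ⊤ → γ ω = 0) : SimpleStrategy 𝓕 where
  c := 0
  τ
    | 0 => fun _ => 0
    | k + 1 => fun ω => min (max (G.τ k ω) (α ω)) (β ω)
  g
    | 0 => fun _ => 0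
    | k + 1 => {ω | max (G.τ k ω) (α ω) ≤ β ω}.indicator fun ω => γ ω * G.g k ω
  proper := by
    refine ⟨?_, ?_, fun _ => rfl, fun ω => ?_⟩
    · rintro (_ | k)
      · exact isStoppingTime_const 𝓕 0
      · exact ((G.proper.1 k).max hα).min hβ
    · rintro (_ | k) ω
      · exact bot_le
      · exact min_le_min_right _ (max_le_max_right _ (G.proper.2.1 k ω))
    · rcases G.proper.2.2.2 ω with h | ⟨n, hn⟩
      · by_cases hβ' : β ω = ⊤
        · left
          intro t
          obtain ⟨N, hN⟩ := eventually_atTop.1 (h t)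
          refine eventually_atTop.2 ⟨N + 1, ?_⟩
          rintro (_ | k) hk
          · omega
          · simpa [hβ'] using lt_max_of_lt_left (b := G.τ k ω) (c := α ω) (hN k (by omega))
        · right
          obtain ⟨b, hb⟩ := WithTop.ne_top_iff_exists.1 hβ'
          obtain ⟨N, hN⟩ := eventually_atTop.1 (h b)
          refine ⟨N + 1, ?_⟩
          have key : ∀ k, N ≤ k → min (max (G.τ k ω) (α ω)) (β ω) = β ω := fun k hk =>
            min_eq_right (le_max_of_le_left (hb ▸ (hN k hk).le))
          rintro (_ | k) hk
          · omega
          · simp only [key k (by omega), key N le_rfl]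
      · right
        refine ⟨n + 1, ?_⟩
        rintro (_ | k) hk
        · omega
        · simp only [hn k (by omega)]
  measurable := by
    rintro (_ | k)
    · exact measurable_const
    · have hm := (G.proper.1 k).max hα
      refine measurable_indicator_le_stopping hm hβ (g := fun ω => γ ω * G.g k ω) ?_
      refine Measurable.mul ?_ ?_
      · exact hγ.mono (hα.measurableSpace_mono hm fun ω => le_max_right _ _) le_rfl
      · exact (G.measurable k).mono
          ((G.proper.1 k).measurableSpace_mono hm fun ω => le_max_left _ _) le_rfl
  bounded := by
    rintro (_ | k)
    · exact ⟨0, fun _ => by simp⟩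
    · obtain ⟨C, hC⟩ := hb
      obtain ⟨D, hD⟩ := G.bounded k
      refine ⟨C * D, fun ω => ?_⟩
      have hC0 : 0 ≤ C := (abs_nonneg _).trans (hC ω)
      have hD0 : 0 ≤ D := (abs_nonneg _).trans (hD ω)
      simp only [Set.indicator]
      split_ifs
      · rw [abs_mul]
        exact mul_le_mul (hC ω) (hD ω) (abs_nonneg _) hC0
      · simpa using mul_nonneg hC0 hD0
  zero_of_top := by
    rintro (_ | k) ω h
    · rfl
    · have h1 : max (G.τ k ω) (α ω) = ⊤ := by
        have : (⊤ : WithTop ℝ≥0) ≤ min (max (G.τ k ω) (α ω)) (β ω) := h.ge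
        exact top_le_iff.1 (this.trans (min_le_left _ _))
      simp only [Set.indicator]
      split_ifs
      · rcases max_choice (G.τ k ω) (α ω) with h2 | h2
        · rw [G.zero_of_top k ω (h2 ▸ h1), mul_zero]
        · rw [htop ω (h2 ▸ h1), zero_mul]
      · rfl

lemma SimpleStrategy.segment_integral {𝓕 : Filtration ℝ≥0 mΩ} (G : SimpleStrategy 𝓕)
    {α β : Ω → WithTop ℝ≥0} (hα : IsStoppingTime 𝓕 α) (hβ : IsStoppingTime 𝓕 β)
    (hle : ∀ ω, α ω ≤ β ω) {γ : Ω → ℝ}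
    (hγ : Measurable[hα.measurableSpace] γ) (hb : ∃ C, ∀ ω, |γ ω| ≤ C)
    (htop : ∀ ω, α ω = ⊤ → γ ω = 0) (S : ℝ≥0 → Ω → ℝ) (t : ℝ≥0) (ω : Ω) :
    (G.segment hα hβ hγ hb htop).integral S t ω =
      γ ω * (G.integral S (cut (β ω) t) ω - G.integral S (cut (α ω) t) ω) := by
  obtain ⟨N₁, h1⟩ := G.exists_integral_eq t ω
  obtain ⟨N₂, h2⟩ := (G.segment hα hβ hγ hb htop).exists_integral_eq t ω
  rw [h2 (max N₁ N₂ + 1) (by omega) t le_rfl S, h1 (max N₁ N₂) (by omega) _ (cut_le _ _) S,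
    h1 (max N₁ N₂) (by omega) _ (cut_le _ _) S]
  simp only [partialSum]
  rw [Finset.sum_range_succ', add_sub_add_left_eq_sub, ← Finset.sum_sub_distrib, Finset.mul_sum]
  simp only [segment, zero_mul, add_zero, zero_add]
  refine Finset.sum_congr rfl fun k _ => ?_
  by_cases h : max (G.τ k ω) (α ω) ≤ β ω
  · rw [Set.indicator_of_mem (show ω ∈ {ω | max (G.τ k ω) (α ω) ≤ β ω} from h),
      apply_cut_min_max (f := fun s => S s ω) (hle ω),
      apply_cut_min_max (f := fun s => S s ω) (hle ω)]
    ring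
  · have h3 : β ω ≤ G.τ k ω := by
      rcases lt_max_iff.1 (not_le.1 h) with h | h
      · exact h.le
      · exact absurd h (not_lt.2 (hle ω))
    have h4 := h3.trans (G.proper.2.1 k ω)
    rw [Set.indicator_of_notMem (show ω ∉ {ω | max (G.τ k ω) (α ω) ≤ β ω} from h)]
    simp only [cut_cut, min_eq_right h3, min_eq_right h4, min_eq_right ((hle ω).trans h3),
      min_eq_right ((hle ω).trans h4)]
    ring

lemma IsSimpleCapital.segment {𝔐 : MartingaleSpace Ω d} {X : ℝ≥0 → Ω → ℝ}
    (hX : IsSimpleCapital 𝔐 X) {α β : Ω → WithTop ℝ≥0} (hα : IsStoppingTime 𝔐.𝓕 α)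
    (hβ : IsStoppingTime 𝔐.𝓕 β) (hle : ∀ ω, α ω ≤ β ω) {γ : Ω → ℝ}
    (hγ : Measurable[hα.measurableSpace] γ) (hb : ∃ C, ∀ ω, |γ ω| ≤ C)
    (htop : ∀ ω, α ω = ⊤ → γ ω = 0) :
    IsSimpleCapital 𝔐 fun t ω => γ ω * (X (cut (β ω) t) ω - X (cut (α ω) t) ω) := by
  obtain ⟨G, hG⟩ := hX
  refine ⟨fun j => (G j).segment hα hβ hγ hb htop, fun t ω => ?_⟩
  simp only [hG, (G _).segment_integral hα hβ hle hγ hb htop, ← Finset.sum_sub_distrib,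
    Finset.mul_sum]

/-- A simple integral of a simple capital process, stopped before it becomes negative, is a
nonnegative supermartingale. -/
lemma isNonnegSupermartingale_stopped_integral (hd : 1 ≤ d) {𝔐 : MartingaleSpace Ω d}
    {X : ℝ≥0 → Ω → ℝ} (hX : IsSimpleCapital 𝔐 X) (G : SimpleStrategy 𝔐.𝓕) {T : Ω → WithTop ℝ≥0}
    (hT : IsStoppingTime 𝔐.𝓕 T) (h0 : ∀ t ω, 0 ≤ G.integral X (cut (T ω) t) ω) :
    IsNonnegSupermartingale 𝔐 (toGen fun t ω => G.integral X (cut (T ω) t) ω) := by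
  have hN : ∀ N, IsNonnegSupermartingale 𝔐
      (toGen fun t ω => G.partialSum X N (cut (T ω) t) ω) := by
    intro N
    have hnn : ∀ N t ω, 0 ≤ G.partialSum X N (cut (T ω) t) ω := fun N t ω => by
      rw [← G.integral_cut, cut_comm]; exact h0 _ ω
    induction N with
    | zero =>
      refine .capital _ ?_ (hnn 0)
      simpa [SimpleStrategy.partialSum] using isSimpleCapital_const hd 𝔐 G.c
    | succ N ih =>
      have hα := (G.proper.1 N).min hT
      have hβ := (G.proper.1 (N + 1)).min hT
      have hY := hX.segment hα hβ (fun ω => min_le_min_right _ (G.proper.2.1 N ω))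
        (γ := {ω | G.τ N ω ≤ T ω}.indicator (G.g N))
        (measurable_indicator_le_stopping (G.proper.1 N) hT (G.measurable N))
        (by
          obtain ⟨C, hC⟩ := G.bounded N
          refine ⟨C, fun ω => ?_⟩
          simp only [Set.indicator]
          split_ifs
          · exact hC ω
          · simpa using (abs_nonneg _).trans (hC ω))
        (fun ω h => by
          have h1 : G.τ N ω = ⊤ := top_le_iff.1 (h.ge.trans (min_le_left _ _))
          simp [Set.indicator, G.zero_of_top N ω h1])
      have key : ∀ t ω, G.partialSum X (N + 1) (cut (T ω) t) ω =
          G.partialSum X N (cut (T ω) t) ω + {ω | G.τ N ω ≤ T ω}.indicator (G.g N) ω *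
            (X (cut (min (G.τ (N + 1) ω) (T ω)) t) ω - X (cut (min (G.τ N ω) (T ω)) t) ω) := by
        intro t ω
        simp only [SimpleStrategy.partialSum, Finset.sum_range_succ, cut_cut, add_assoc]
        congr 2
        by_cases h : G.τ N ω ≤ T ω
        · rw [Set.indicator_of_mem (by exact h)]
        · have h1 : T ω ≤ G.τ N ω := (not_le.1 h).le
          rw [min_eq_right h1, min_eq_right (h1.trans (G.proper.2.1 N ω))]
          simp
      have := IsNonnegSupermartingale.add _ _ ih hY fun t ω => by
        simp only [toGen, ← EReal.coe_add, ← key]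
        exact EReal.coe_nonneg.2 (hnn _ t ω)
      convert this using 1
      ext t ω
      simp only [toGen, ← EReal.coe_add, ← key]
  convert IsNonnegSupermartingale.liminf _ hN using 1
  ext t ω
  obtain ⟨N₀, h⟩ := G.exists_integral_eq t ω
  symm
  refine Tendsto.liminf_eq (tendsto_const_nhds.congr' ?_)
  filter_upwards [eventually_ge_atTop N₀] with N hN
  simp only [toGen, h N hN _ (cut_le _ t) X]

/-! ### Hitting times of continuous processes -/

open Classical in
/-- The first time at which the process `U` is nonpositive. -/
def firstNonpos (U : ℝ≥0 → Ω → ℝ) (ω : Ω) : WithTop ℝ≥0 :=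
  if {s | U s ω ≤ 0}.Nonempty then ((sInf {s | U s ω ≤ 0} : ℝ≥0) : WithTop ℝ≥0) else ⊤

omit mΩ in
lemma firstNonpos_le {U : ℝ≥0 → Ω → ℝ} {ω : Ω} {s : ℝ≥0} (h : U s ω ≤ 0) :
    firstNonpos U ω ≤ s := by
  have hne : {s | U s ω ≤ 0}.Nonempty := ⟨s, h⟩
  rw [firstNonpos, if_pos hne]
  exact WithTop.coe_le_coe.2 (csInf_le (OrderBot.bddBelow _) h)

omit mΩ in
lemma exists_of_firstNonpos_le {U : ℝ≥0 → Ω → ℝ} {ω : Ω} (hU : Continuous fun s => U s ω) {t : ℝ≥0}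
    (h : firstNonpos U ω ≤ t) : ∃ s, s ≤ t ∧ firstNonpos U ω = s ∧ U s ω ≤ 0 := by
  rw [firstNonpos] at h ⊢
  by_cases hne : {s | U s ω ≤ 0}.Nonempty
  · have hc : IsClosed {s | U s ω ≤ 0} := isClosed_le hU continuous_const
    rw [if_pos hne] at h ⊢
    exact ⟨_, WithTop.coe_le_coe.1 h, rfl, hc.csInf_mem hne (OrderBot.bddBelow _)⟩
  · rw [if_neg hne] at h
    exact absurd (top_le_iff.1 h) WithTop.coe_ne_top

lemma isStoppingTime_firstNonpos {𝓕 : Filtration ℝ≥0 mΩ} {U : ℝ≥0 → Ω → ℝ} (hU : Adapted 𝓕 U)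
    (hc : ∀ ω, Continuous fun s => U s ω) : IsStoppingTime 𝓕 (firstNonpos U) := by
  intro t
  have key : {ω | firstNonpos U ω ≤ t} =
      ⋂ k : ℕ, ⋃ q : ℕ, {ω | U (min (TopologicalSpace.denseSeq ℝ≥0 q) t) ω < 1 / (k + 1 : ℝ)} := by
    ext ω
    simp only [Set.mem_ofPred_eq, Set.mem_iInter, Set.mem_iUnion]
    constructor
    · intro h k
      obtain ⟨s, hs, -, hs'⟩ := exists_of_firstNonpos_le (hc ω) h
      have ho : IsOpen {q : ℝ≥0 | U (min q t) ω < 1 / (k + 1 : ℝ)} :=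
        isOpen_lt ((hc ω).comp (continuous_id.min continuous_const)) continuous_const
      obtain ⟨q, hq⟩ := (TopologicalSpace.denseRange_denseSeq ℝ≥0).exists_mem_open ho
        ⟨s, by
          simp only [Set.mem_ofPred_eq, min_eq_left hs]
          exact hs'.trans_lt (by positivity)⟩
      exact ⟨q, hq⟩
    · intro h
      obtain ⟨s, hs, hs'⟩ := (isCompact_Icc (a := (0 : ℝ≥0)) (b := t)).exists_isMinOn
        ⟨0, by simp⟩ (hc ω).continuousOn
      refine (firstNonpos_le (s := s) ?_).trans (by exact_mod_cast hs.2)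
      refine le_of_forall_pos_lt_add fun ε hε => ?_
      obtain ⟨k, hk⟩ := exists_nat_one_div_lt hε
      obtain ⟨q, hq⟩ := h k
      have h1 : U s ω ≤ U (min (TopologicalSpace.denseSeq ℝ≥0 q) t) ω :=
        hs' ⟨bot_le, min_le_right _ _⟩
      linarith
  rw [key]
  refine MeasurableSet.iInter fun k => MeasurableSet.iUnion fun q => ?_
  exact measurableSet_lt (hU.measurable_le (min_le_right _ _)) measurable_const

/-! ### Locally uniform convergence -/

lemma toReal_sub_le_of_abs_sub_le {a b : EReal} {ε : ℝ} (hε : 0 ≤ ε)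
    (h : (a - b).abs ≤ ENNReal.ofReal ε) :
    (a ≠ ⊤ ∧ a ≠ ⊥) ∧ (b ≠ ⊤ ∧ b ≠ ⊥) ∧ |a.toReal - b.toReal| ≤ ε := by
  induction a <;> induction b <;> simp_all [← EReal.coe_sub, EReal.abs_def]

omit mΩ in
lemma eventually_of_tendsto_supDist {X : ℕ → GenProcess Ω} {Z : GenProcess Ω} {t : ℝ≥0} {ω : Ω}
    (h : Tendsto (fun n => supDist (X n) Z t ω) atTop (𝓝 0)) {ε : ℝ} (hε : 0 < ε) :
    ∀ᶠ n in atTop, ∀ s, s ≤ t → (X n s ω ≠ ⊤ ∧ X n s ω ≠ ⊥) ∧ (Z s ω ≠ ⊤ ∧ Z s ω ≠ ⊥) ∧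
      |(X n s ω).toReal - (Z s ω).toReal| ≤ ε := by
  have h1 : ∀ᶠ n in atTop, supDist (X n) Z t ω < ENNReal.ofReal ε :=
    h.eventually_lt_const (by simpa using hε)
  filter_upwards [h1] with n hn s hs
  refine toReal_sub_le_of_abs_sub_le hε.le (le_trans ?_ hn.le)
  exact le_iSup₂ (f := fun (s : ℝ≥0) (_ : s ≤ t) => (X n s ω - Z s ω).abs) s hs

omit mΩ in
lemma tendsto_supDist_of_eventually {X : ℕ → GenProcess Ω} {Z : GenProcess Ω} {t : ℝ≥0} {ω : Ω}
    (h : ∀ ε : ℝ, 0 < ε → ∀ᶠ n in atTop, ∀ s, s ≤ t → ∃ x z : ℝ, X n s ω = x ∧ Z s ω = z ∧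
      |x - z| ≤ ε) :
    Tendsto (fun n => supDist (X n) Z t ω) atTop (𝓝 0) := by
  rw [ENNReal.tendsto_nhds_zero]
  intro ε hε
  by_cases htop : ε = ⊤
  · simp [htop]
  filter_upwards [h ε.toReal (ENNReal.toReal_pos hε.ne' htop)] with n hn
  refine iSup₂_le fun s hs => ?_
  obtain ⟨x, z, hx, hz, hxz⟩ := hn s hs
  rw [hx, hz, ← EReal.coe_sub, EReal.abs_def]
  exact ENNReal.ofReal_le_of_le_toReal hxz

omit mΩ in
lemma supDist_mono {Y Z : GenProcess Ω} {s t : ℝ≥0} (h : s ≤ t) (ω : Ω) :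
    supDist Y Z s ω ≤ supDist Y Z t ω :=
  biSup_mono fun _ hr => hr.trans h

/-- The trajectory of `X` at `ω` is real and continuous on `[0, t]`. -/
def IsRegularUpTo (X : GenProcess Ω) (t : ℝ≥0) (ω : Ω) : Prop :=
  (∀ s, s ≤ t → X s ω ≠ ⊤ ∧ X s ω ≠ ⊥) ∧ ContinuousOn (fun s => (X s ω).toReal) (Set.Iic t)

omit mΩ in
lemma IsRegularUpTo.mono {X : GenProcess Ω} {s t : ℝ≥0} {ω : Ω} (h : IsRegularUpTo X t ω)
    (hst : s ≤ t) : IsRegularUpTo X s ω :=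
  ⟨fun r hr => h.1 r (hr.trans hst), h.2.mono (Set.Iic_subset_Iic.2 hst)⟩

/-- Trajectories of martingales are real and continuous up to the present w.i.e. -/
lemma IsMartingale.isRegularUpTo (hd : 1 ≤ d) {𝔐 : MartingaleSpace Ω d} {X : GenProcess Ω}
    (hX : IsMartingale 𝔐 X) : InstantlyEnforceable 𝔐 {p | IsRegularUpTo X p.1 p.2} := by
  induction hX with
  | capital Y hY =>
    refine (InstantlyEnforceable.univ hd 𝔐).mono fun p _ => ?_
    exact ⟨fun s _ => by simp [toGen], by simpa [toGen] using (hY.continuous p.2).continuousOn⟩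
  | lim X Z hX hZ hreal hlim ih =>
    refine ((InstantlyEnforceable.iInter hd ih).inter hd hlim).mono ?_
    rintro ⟨t, ω⟩ ⟨h1, h2⟩
    simp only [Set.mem_iInter, Set.mem_ofPred_eq] at h1 h2
    refine ⟨fun s hs => ?_, ?_⟩
    · obtain ⟨n, hn⟩ := (eventually_of_tendsto_supDist h2 one_pos).exists
      exact (hn s hs).2.1
    · refine TendstoUniformlyOn.continuousOn (p := atTop)
        (F := fun n s => (X n s ω).toReal) ?_ (Frequently.of_forall fun n => (h1 n).2)
      rw [Metric.tendstoUniformlyOn_iff]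
      intro ε hε
      filter_upwards [eventually_of_tendsto_supDist h2 (half_pos hε)] with n hn s hs
      rw [dist_comm, Real.dist_eq]
      linarith [(hn s hs).2.2]

/-- Simple integrals with respect to a martingale are hedged by nonnegative supermartingales: from
the initial capital of the integral one can secure the level `b` if the integral passes `b` while
bounded away from zero. The margin `ε` makes the property stable under uniform limits, so that
the induction over the class of martingales goes through without stopping the limit. -/
lemma IsMartingale.exists_superhedge (hd : 1 ≤ d) {𝔐 : MartingaleSpace Ω d} {X : GenProcess Ω}
    (hX : IsMartingale 𝔐 X) (G : SimpleStrategy 𝔐.𝓕) (hc : 0 < G.c) (b : ℝ) :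
    ∃ Y : GenProcess Ω, IsNonnegSupermartingale 𝔐 Y ∧ (∀ ω, Y 0 ω = G.c) ∧
      InstantlyEnforceable 𝔐 {p | ∀ ε > 0, ∀ s ≤ p.1,
        (∀ r ≤ s, ε ≤ G.integral (fun t ω => (X t ω).toReal) r p.2) →
        b + ε ≤ G.integral (fun t ω => (X t ω).toReal) s p.2 → (b : EReal) ≤ Y p.1 p.2} := by
  induction hX with
  | capital X hX =>
    have hXr : (fun t ω => (toGen X t ω).toReal) = X := by ext; simp [toGen]
    simp only [hXr]
    have hZc : ∀ ω, Continuous fun t => G.integral X t ω := fun ω =>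
      G.continuous_integral (hX.continuous ω)
    have hZa : Adapted 𝔐.𝓕 (G.integral X) := G.adapted_integral hX.adapted hX.continuous
    -- Stop as soon as the integral vanishes or reaches the level `b`.
    let U : ℝ≥0 → Ω → ℝ := fun t ω => min (G.integral X t ω) (b - G.integral X t ω)
    have hUc : ∀ ω, Continuous fun t => U t ω := fun ω =>
      (hZc ω).min (continuous_const.sub (hZc ω))
    have hT : IsStoppingTime 𝔐.𝓕 (firstNonpos U) :=
      isStoppingTime_firstNonpos (fun t => (hZa t).min (measurable_const.sub (hZa t))) hUc
    have h0 : ∀ t ω, 0 ≤ G.integral X (cut (firstNonpos U ω) t) ω := by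
      intro t ω
      by_contra! hneg
      set u := cut (firstNonpos U ω) t with hu
      obtain ⟨v, hv, hv0⟩ := intermediate_value_Icc' (zero_le : (0 : ℝ≥0) ≤ u)
        (hZc ω).continuousOn (show (0 : ℝ) ∈ Set.Icc _ _ from ⟨hneg.le, by simpa using hc.le⟩)
      have h1 : firstNonpos U ω ≤ v := firstNonpos_le ((min_le_left _ _).trans hv0.le)
      have h2 : u ≤ v := by
        have := (coe_cut_le (firstNonpos U ω) t).trans h1
        exact_mod_cast this
      have h3 : v = u := le_antisymm hv.2 h2
      dsimp only at hv0
      rw [h3] at hv0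
      exact hneg.ne hv0
    refine ⟨_, isNonnegSupermartingale_stopped_integral hd hX G hT h0, fun ω => ?_,
      (InstantlyEnforceable.univ hd 𝔐).mono ?_⟩
    · simp [toGen]
    · rintro ⟨t, ω⟩ -
      intro ε hε s hs hpos hb
      dsimp only at hs hpos hb ⊢
      have hT' : firstNonpos U ω ≤ s := firstNonpos_le ((min_le_right _ _).trans (by linarith))
      obtain ⟨v, hv, hTv, hv'⟩ := exists_of_firstNonpos_le (hUc ω) hT'
      have h1 : cut (firstNonpos U ω) t = v := by
        rw [← WithTop.coe_inj, ← hTv]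
        exact coe_cut_of_ge (hT'.trans (by exact_mod_cast hs))
      simp only [toGen, h1]
      have h2 := hpos v hv
      rcases min_le_iff.1 hv' with h3 | h3
      · linarith
      · exact_mod_cast (by linarith : b ≤ G.integral X v ω)
  | lim X Z hX hZ hreal hlim ih =>
    choose Y hY hY0 hYE using ih
    refine ⟨_, .liminf Y hY, fun ω => by simp [hY0], ?_⟩
    refine ((InstantlyEnforceable.iInter hd hYE).inter hd hlim).mono ?_
    rintro ⟨t, ω⟩ ⟨h1, h2⟩
    simp only [Set.mem_iInter, Set.mem_ofPred_eq] at h1 h2 ⊢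
    intro ε hε s hs hpos hb
    obtain ⟨N, hN⟩ := G.exists_integral_eq t ω
    set A := ∑ n ∈ Finset.range N, |G.g n ω| with hA
    have hA0 : 0 ≤ A := Finset.sum_nonneg fun _ _ => abs_nonneg _
    have hη : 0 < ε / (4 * (A + 1)) := by positivity
    refine le_liminf_of_le (by isBoundedDefault) ?_
    filter_upwards [eventually_of_tendsto_supDist h2 hη] with n hn
    have key : ∀ r ≤ t, |G.integral (fun t ω => (X n t ω).toReal) r ω -
        G.integral (fun t ω => (Z t ω).toReal) r ω| ≤ ε / 2 := by
      intro r hr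
      rw [hN N le_rfl r hr, hN N le_rfl r hr]
      simp only [SimpleStrategy.partialSum]
      rw [add_sub_add_left_eq_sub, ← Finset.sum_sub_distrib]
      calc _ ≤ ∑ k ∈ Finset.range N, |G.g k ω| * (2 * (ε / (4 * (A + 1)))) := by
            refine (Finset.abs_sum_le_sum_abs _ _).trans (Finset.sum_le_sum fun k _ => ?_)
            rw [← mul_sub, abs_mul]
            refine mul_le_mul_of_nonneg_left ?_ (abs_nonneg _)
            have e1 := (hn _ ((cut_le (G.τ (k + 1) ω) r).trans hr)).2.2
            have e2 := (hn _ ((cut_le (G.τ k ω) r).trans hr)).2.2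
            rw [abs_le] at e1 e2 ⊢
            constructor <;> linarith
        _ = A * (2 * (ε / (4 * (A + 1)))) := by rw [← Finset.sum_mul]
        _ ≤ ε / 2 := by
            rw [show A * (2 * (ε / (4 * (A + 1)))) = (ε / 2) * (A / (A + 1)) by
              field_simp; norm_num]
            refine mul_le_of_le_one_right (by positivity) ?_
            rw [div_le_one (by positivity)]; linarith
    refine h1 n (ε / 2) (by positivity) s hs (fun r hr => ?_) ?_
    · have := abs_le.1 (key r (hr.trans hs))
      linarith [hpos r hr]
    · have := abs_le.1 (key s hs)
      linarith

/-! ### Progressively measurable versions -/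

/-- The last point of the dyadic grid of mesh `2⁻ᵏ` that does not exceed `t`. -/
def gridFloor (k : ℕ) (t : ℝ≥0) : ℝ≥0 := (⌊t * 2 ^ k⌋₊ : ℝ≥0) / 2 ^ k

lemma gridFloor_le (k : ℕ) (t : ℝ≥0) : gridFloor k t ≤ t := by
  rw [gridFloor, div_le_iff₀ (by positivity)]
  exact Nat.floor_le zero_le

lemma lt_gridFloor_add (k : ℕ) (t : ℝ≥0) : t < gridFloor k t + (1 / 2) ^ k := by
  rw [gridFloor, one_div, inv_pow, ← one_div, ← add_div, lt_div_iff₀ (by positivity)]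
  exact Nat.lt_floor_add_one _

lemma tendsto_gridFloor (t : ℝ≥0) : Tendsto (fun k => gridFloor k t) atTop (𝓝 t) := by
  refine tendsto_of_tendsto_of_tendsto_of_le_of_le (g := fun k => t - (1 / 2) ^ k) ?_
    tendsto_const_nhds (fun k => ?_) fun k => gridFloor_le k t
  · have h : Tendsto (fun k : ℕ => ((1 : ℝ≥0) / 2) ^ k) atTop (𝓝 0) :=
      NNReal.tendsto_pow_atTop_nhds_zero_of_lt_one (NNReal.half_lt_self one_ne_zero)
    simpa using (tendsto_const_nhds (x := t)).sub h
  · exact tsub_le_iff_right.2 (lt_gridFloor_add k t).le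

/-- A real progressively measurable version of `X`, the upper limit of `X` along dyadic times from
the left. It agrees with `X` as long as the trajectory is real and continuous. -/
def leftVersion (X : GenProcess Ω) : ℝ≥0 → Ω → ℝ := fun t ω =>
  (limsup (fun k => X (gridFloor k t) ω) atTop).toReal

omit mΩ in
lemma leftVersion_eq {X : GenProcess Ω} {s t : ℝ≥0} {ω : Ω} (h : IsRegularUpTo X t ω)
    (hs : s ≤ t) : leftVersion X s ω = (X s ω).toReal := by
  have h1 : Tendsto (fun k => (X (gridFloor k s) ω).toReal) atTop (𝓝 (X s ω).toReal) := by
    refine (h.2 s hs).tendsto.comp (tendsto_nhdsWithin_iff.2 ⟨tendsto_gridFloor s, ?_⟩)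
    exact Eventually.of_forall fun k => (gridFloor_le k s).trans hs
  have h2 : Tendsto (fun k => X (gridFloor k s) ω) atTop (𝓝 (X s ω)) := by
    have h3 := (continuous_coe_real_ereal.tendsto _).comp h1
    rw [EReal.coe_toReal (h.1 s hs).1 (h.1 s hs).2] at h3
    refine h3.congr fun k => ?_
    have h4 := h.1 _ ((gridFloor_le k s).trans hs)
    exact EReal.coe_toReal h4.1 h4.2
  rw [leftVersion, h2.limsup_eq]

lemma isStronglyProgressive_leftVersion {𝓕 : Filtration ℝ≥0 mΩ} {X : GenProcess Ω}
    (hX : Adapted 𝓕 X) : IsStronglyProgressive 𝓕 (leftVersion X) := by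
  refine IsProgressive.isStronglyProgressive fun i => ?_
  let : MeasurableSpace Ω := 𝓕 i
  refine measurable_ereal_toReal.comp (Measurable.limsup fun k => ?_)
  have h1 : Measurable fun q : (Set.Iic i × Ω) × ℕ =>
      X (min ((q.2 : ℝ≥0) / 2 ^ k) i) q.1.2 := by
    refine measurable_from_prod_countable_left fun j => ?_
    exact (hX.measurable_le (min_le_right ((j : ℝ≥0) / 2 ^ k) i)).comp measurable_snd
  have h2 : Measurable fun p : Set.Iic i × Ω => (p, ⌊(p.1 : ℝ≥0) * 2 ^ k⌋₊) := by
    refine measurable_id.prodMk (Nat.measurable_floor.comp ?_)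
    exact (measurable_subtype_coe.comp measurable_fst).mul_const _
  convert! h1.comp h2 using 1
  ext p
  simp only [Function.comp]
  rw [min_eq_left]
  · rfl
  · exact (gridFloor_le k _).trans p.1.2

/-! ### Merging sequences of stopping times -/

/-- The increasing enumeration of `0` and the positive values of the times `θ i`, with the value `⊤`
once these are exhausted. -/
def mergeTimes {ι : Type*} (θ : ι → Ω → WithTop ℝ≥0) : ℕ → Ω → WithTop ℝ≥0
  | 0 => fun _ => 0
  | n + 1 => fun ω => ⨅ (i : ι) (_ : mergeTimes θ n ω < θ i ω), θ i ω

section Merge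

variable {ι : Type*} {θ : ι → Ω → WithTop ℝ≥0}

omit mΩ in
lemma mergeTimes_succ_le {n : ℕ} {ω : Ω} {i : ι} (h : mergeTimes θ n ω < θ i ω) :
    mergeTimes θ (n + 1) ω ≤ θ i ω := iInf₂_le i h

omit mΩ in
lemma mergeTimes_le_succ (n : ℕ) (ω : Ω) : mergeTimes θ n ω ≤ mergeTimes θ (n + 1) ω :=
  le_iInf₂ fun _ h => h.le

omit mΩ in
lemma exists_of_mergeTimes_succ_le (hfin : ∀ ω, ∀ t : ℝ≥0, {a | a ≤ ↑t ∧ ∃ i, θ i ω = a}.Finite)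
    {n : ℕ} {ω : Ω} {t : ℝ≥0} (h : mergeTimes θ (n + 1) ω ≤ t) :
    ∃ i, mergeTimes θ n ω < θ i ω ∧ mergeTimes θ (n + 1) ω = θ i ω := by
  set A : Set (WithTop ℝ≥0) := {a | a ≤ ((t + 1 : ℝ≥0) : WithTop ℝ≥0) ∧
    ∃ i, mergeTimes θ n ω < θ i ω ∧ θ i ω = a} with hA
  have hAf : A.Finite := (hfin ω (t + 1)).subset fun a ⟨h1, i, _, h2⟩ => ⟨h1, i, h2⟩
  have hne : A.Nonempty := by
    by_contra hne
    have h1 : (((t + 1 : ℝ≥0) : WithTop ℝ≥0)) ≤ mergeTimes θ (n + 1) ω := by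
      refine le_iInf₂ fun i hi => ?_
      by_contra hlt
      exact hne ⟨θ i ω, (not_le.1 hlt).le, i, hi, rfl⟩
    have h2 : t + 1 ≤ t := by exact_mod_cast h1.trans h
    exact absurd h2 (not_le.2 (lt_add_one t))
  obtain ⟨a, ⟨ha, i, hi, hia⟩, hmin⟩ := hAf.exists_minimal hne
  refine ⟨i, hi, le_antisymm (mergeTimes_succ_le hi) (le_iInf₂ fun j hj => ?_)⟩
  rw [hia]
  rcases le_total (θ j ω) ((t + 1 : ℝ≥0) : WithTop ℝ≥0) with h1 | h1
  · by_contra hlt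
    exact hlt (hmin ⟨h1, j, hj, rfl⟩ (not_le.1 hlt).le)
  · exact ha.trans h1

omit mΩ in
lemma eventually_lt_mergeTimes
    (hfin : ∀ ω, ∀ t : ℝ≥0, {a | a ≤ ↑t ∧ ∃ i, θ i ω = a}.Finite) (ω : Ω) (t : ℝ≥0) :
    ∀ᶠ n in atTop, (t : WithTop ℝ≥0) < mergeTimes θ n ω := by
  have hmono : Monotone fun n => mergeTimes θ n ω :=
    monotone_nat_of_le_succ fun n => mergeTimes_le_succ n ω
  suffices h : ∃ n, (t : WithTop ℝ≥0) < mergeTimes θ n ω by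
    obtain ⟨n, hn⟩ := h
    filter_upwards [eventually_ge_atTop n] with k hk
    exact hn.trans_le (hmono hk)
  by_contra! hle
  have hstrict : StrictMono fun n => mergeTimes θ (n + 1) ω := by
    refine strictMono_nat_of_lt_succ fun n => ?_
    obtain ⟨i, hi, hi'⟩ := exists_of_mergeTimes_succ_le hfin (hle (n + 2))
    exact hi'.symm ▸ hi
  refine Set.infinite_of_injective_forall_mem hstrict.injective (fun n => ?_) (hfin ω t)
  obtain ⟨i, _, hi⟩ := exists_of_mergeTimes_succ_le hfin (hle (n + 1))
  exact ⟨hle (n + 1), i, hi.symm⟩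

lemma isStoppingTime_mergeTimes [Countable ι] {𝓕 : Filtration ℝ≥0 mΩ}
    (hθ : ∀ i, IsStoppingTime 𝓕 (θ i))
    (hfin : ∀ ω, ∀ t : ℝ≥0, {a | a ≤ ↑t ∧ ∃ i, θ i ω = a}.Finite) (n : ℕ) :
    IsStoppingTime 𝓕 (mergeTimes θ n) := by
  induction n with
  | zero => exact isStoppingTime_const 𝓕 0
  | succ n ih =>
    intro t
    have key : {ω | mergeTimes θ (n + 1) ω ≤ t} =
        ⋃ i, {ω | θ i ω ≤ mergeTimes θ n ω}ᶜ ∩ {ω | θ i ω ≤ t} := by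
      ext ω
      simp only [Set.mem_ofPred_eq, Set.mem_iUnion, Set.mem_inter_iff, Set.mem_compl_iff, not_le]
      constructor
      · intro h
        obtain ⟨i, hi, hi'⟩ := exists_of_mergeTimes_succ_le hfin h
        exact ⟨i, hi, hi' ▸ h⟩
      · rintro ⟨i, hi, hi'⟩
        exact (mergeTimes_succ_le hi).trans hi'
    rw [key]
    exact MeasurableSet.iUnion fun i =>
      (((hθ i).measurableSet_le_stopping_time ih).compl).2 t

lemma isProper_mergeTimes [Countable ι] {𝓕 : Filtration ℝ≥0 mΩ}
    (hθ : ∀ i, IsStoppingTime 𝓕 (θ i))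
    (hfin : ∀ ω, ∀ t : ℝ≥0, {a | a ≤ ↑t ∧ ∃ i, θ i ω = a}.Finite) :
    IsProper 𝓕 (mergeTimes θ) :=
  ⟨isStoppingTime_mergeTimes hθ hfin, mergeTimes_le_succ, fun _ => rfl, fun ω =>
    Or.inl (eventually_lt_mergeTimes hfin ω)⟩

end Merge

lemma IsProper.finite_values {𝓕 : Filtration ℝ≥0 mΩ} {σ : ℕ → Ω → WithTop ℝ≥0}
    (hσ : IsProper 𝓕 σ) (ω : Ω) (t : ℝ≥0) : {a | a ≤ ↑t ∧ ∃ i, σ i ω = a}.Finite := by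
  obtain ⟨N, hN⟩ : ∃ N, ∀ k, N ≤ k → σ k ω ≤ t → σ k ω = σ N ω := by
    rcases hσ.2.2.2 ω with h | ⟨N, hN⟩
    · obtain ⟨N, hN⟩ := eventually_atTop.1 (h t)
      exact ⟨N, fun k hk hle => absurd (hN k hk) (not_lt.2 hle)⟩
    · exact ⟨N, fun k hk _ => hN k hk⟩
  refine ((Finset.range (N + 1)).image fun i => σ i ω).finite_toSet.subset ?_
  rintro _ ⟨ha, i, rfl⟩
  simp only [Finset.coe_image, Finset.coe_range, Set.mem_image, Set.mem_Iio]
  rcases lt_or_ge i N with h | h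
  · exact ⟨i, by omega, rfl⟩
  · exact ⟨N, by omega, (hN i h ha).symm⟩

lemma finite_values_sumElim {𝓕 : Filtration ℝ≥0 mΩ} {σ ρ : ℕ → Ω → WithTop ℝ≥0}
    (hσ : IsProper 𝓕 σ) (hρ : IsProper 𝓕 ρ) (ω : Ω) (t : ℝ≥0) :
    {a | a ≤ ↑t ∧ ∃ i, Sum.elim σ ρ i ω = a}.Finite := by
  refine ((hσ.finite_values ω t).union (hρ.finite_values ω t)).subset ?_
  rintro a ⟨ha, i | i, hi⟩
  · exact Or.inl ⟨ha, i, hi⟩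
  · exact Or.inr ⟨ha, i, hi⟩

open Classical in
/-- The value of `ξ` at the last of the times `σ` that does not exceed `τ n`, in case all
times `σ` are among the times `τ`. -/
def lastValue (ξ : ℝ≥0 → Ω → ℝ) (τ σ : ℕ → Ω → WithTop ℝ≥0) : ℕ → Ω → ℝ
  | 0 => stoppedValue ξ (τ 0)
  | n + 1 => fun ω => if ∃ k, σ k ω = τ (n + 1) ω then stoppedValue ξ (τ (n + 1)) ω
      else lastValue ξ τ σ n ω

lemma measurable_lastValue {𝓕 : Filtration ℝ≥0 mΩ} {ξ : ℝ≥0 → Ω → ℝ}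
    (hξ : IsStronglyProgressive 𝓕 ξ) {τ σ : ℕ → Ω → WithTop ℝ≥0} (hτ : IsProper 𝓕 τ)
    (hσ : ∀ k, IsStoppingTime 𝓕 (σ k)) (n : ℕ) :
    Measurable[(hτ.1 n).measurableSpace] (lastValue ξ τ σ n) := by
  induction n with
  | zero => exact measurable_stoppedValue hξ (hτ.1 0)
  | succ n ih =>
    have hmono := (hτ.1 n).measurableSpace_mono (hτ.1 (n + 1)) (hτ.2.1 n)
    refine Measurable.ite ?_ (measurable_stoppedValue hξ (hτ.1 (n + 1))) (ih.mono hmono le_rfl)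
    have : {ω | ∃ k, σ k ω = τ (n + 1) ω} = ⋃ k, {ω | τ (n + 1) ω = σ k ω} := by
      ext ω; simp [eq_comm]
    rw [this]
    exact MeasurableSet.iUnion fun k => (hτ.1 (n + 1)).measurableSet_eq_stopping_time (hσ k)

/-- The value at `τ n` of the difference of the quadratic variations along `σ` and `ρ`, as a
simple integral along the common refinement `τ`. -/
def qvDiff (ξ : ℝ≥0 → Ω → ℝ) (τ σ ρ : ℕ → Ω → WithTop ℝ≥0) : ℕ → Ω → ℝ
  | 0 => fun _ => 0
  | n + 1 => fun ω => qvDiff ξ τ σ ρ n ω +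
      2 * (lastValue ξ τ ρ n ω - lastValue ξ τ σ n ω) *
        (stoppedValue ξ (τ (n + 1)) ω - stoppedValue ξ (τ n) ω)

lemma measurable_qvDiff {𝓕 : Filtration ℝ≥0 mΩ} {ξ : ℝ≥0 → Ω → ℝ}
    (hξ : IsStronglyProgressive 𝓕 ξ) {τ σ ρ : ℕ → Ω → WithTop ℝ≥0} (hτ : IsProper 𝓕 τ)
    (hσ : ∀ k, IsStoppingTime 𝓕 (σ k)) (hρ : ∀ k, IsStoppingTime 𝓕 (ρ k)) (n : ℕ) :
    Measurable[(hτ.1 n).measurableSpace] (qvDiff ξ τ σ ρ n) := by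
  induction n with
  | zero => exact measurable_const
  | succ n ih =>
    have hmono := (hτ.1 n).measurableSpace_mono (hτ.1 (n + 1)) (hτ.2.1 n)
    have h1 := (measurable_lastValue hξ hτ hρ n).mono hmono le_rfl
    have h2 := (measurable_lastValue hξ hτ hσ n).mono hmono le_rfl
    have h3 := (measurable_stoppedValue hξ (hτ.1 n)).mono hmono le_rfl
    have h4 := measurable_stoppedValue hξ (hτ.1 (n + 1))
    exact (ih.mono hmono le_rfl).add (((h1.sub h2).const_mul 2).mul (h4.sub h3))

/-- The strategy whose capital dominates the square of the difference `K` of the quadratic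
variations along `σ` and `ρ`. Up to truncation at the level `L`, its position at `τ n` is
`2 Kₙ aₙ - 2 C Xₙ`, where `aₙ` is the position that generates `K`. -/
def qvStrategy {𝓕 : Filtration ℝ≥0 mΩ} {ξ : ℝ≥0 → Ω → ℝ} (hξ : IsStronglyProgressive 𝓕 ξ)
    {τ σ ρ : ℕ → Ω → WithTop ℝ≥0} (hτ : IsProper 𝓕 τ) (hσ : ∀ k, IsStoppingTime 𝓕 (σ k))
    (hρ : ∀ k, IsStoppingTime 𝓕 (ρ k)) (c C L : ℝ) : SimpleStrategy 𝓕 where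
  c := c
  τ := τ
  g := fun n => {ω | τ n ω = ⊤}ᶜ.indicator fun ω => max (-L) (min L
    (2 * qvDiff ξ τ σ ρ n ω * (2 * (lastValue ξ τ ρ n ω - lastValue ξ τ σ n ω)) -
      2 * C * stoppedValue ξ (τ n) ω))
  proper := hτ
  measurable := fun n => by
    refine Measurable.indicator ?_ ((measurableSet_singleton ⊤).preimage (hτ.1 n).measurable).compl
    refine measurable_const.max (measurable_const.min (Measurable.sub ?_ ?_))
    · exact ((measurable_qvDiff hξ hτ hσ hρ n).const_mul 2).mul
        (((measurable_lastValue hξ hτ hρ n).sub (measurable_lastValue hξ hτ hσ n)).const_mul 2)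
    · exact (measurable_stoppedValue hξ (hτ.1 n)).const_mul _
  bounded := fun n => ⟨|L|, fun ω => by
    simp only [Set.indicator]
    split_ifs
    · rw [abs_le]
      constructor
      · exact (neg_le_neg (le_abs_self L)).trans (le_max_left _ _)
      · exact max_le (neg_le_abs L) ((min_le_left _ _).trans (le_abs_self L))
    · simp⟩
  zero_of_top := fun n ω h => Set.indicator_of_notMem (by simpa using h) _

/-! ### Quadratic variation of a single trajectory -/

/-- The quadratic variation up to time `s` of the trajectory `f` along the times `a`. -/
def qvPath (f : ℝ≥0 → ℝ) (a : ℕ → WithTop ℝ≥0) (s : ℝ≥0) : ℝ :=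
  ∑' n : ℕ, (f (cut (a (n + 1)) s) - f (cut (a n) s)) ^ 2

@[simp] lemma qvPath_zero (f : ℝ≥0 → ℝ) (a : ℕ → WithTop ℝ≥0) : qvPath f a 0 = 0 := by
  simp [qvPath]

lemma qvPath_eq (f : ℝ≥0 → ℝ) {a : ℕ → WithTop ℝ≥0} (ha : Monotone a) {k : ℕ} {u v : ℝ≥0}
    (hu : a k = u) (huv : u ≤ v) (hv : (v : WithTop ℝ≥0) ≤ a (k + 1)) :
    qvPath f a v = ∑ j ∈ Finset.range k, (f (cut (a (j + 1)) u) - f (cut (a j) u)) ^ 2 +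
      (f v - f u) ^ 2 := by
  have huv' : (u : WithTop ℝ≥0) ≤ v := by exact_mod_cast huv
  have hle : ∀ j, j ≤ k → cut (a j) v = cut (a j) u := fun j hj => by
    have h1 : a j ≤ u := (ha hj).trans hu.le
    rw [← WithTop.coe_inj, coe_cut_of_ge h1, coe_cut_of_ge (h1.trans huv')]
  have hge : ∀ j, k < j → cut (a j) v = v := fun j hj => cut_of_le (hv.trans (ha hj))
  rw [qvPath, tsum_eq_sum (s := Finset.range (k + 1)), Finset.sum_range_succ]
  · congr 1
    · refine Finset.sum_congr rfl fun j hj => ?_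
      have hj' := Finset.mem_range.1 hj
      rw [hle j (by omega), hle (j + 1) (by omega)]
    · have h1 : cut (a k) u = u := cut_of_le hu.ge
      rw [hge (k + 1) (by omega), hle k le_rfl, h1]
  · intro n hn
    have hn' : k < n := by simp at hn; omega
    rw [hge n hn', hge (n + 1) (by omega), sub_self, zero_pow two_ne_zero]

lemma qvPath_sub (f : ℝ≥0 → ℝ) {a : ℕ → WithTop ℝ≥0} (ha : Monotone a) {k : ℕ} {u r s : ℝ≥0}
    (hu : a k = u) (hur : u ≤ r) (hrs : r ≤ s) (hs : (s : WithTop ℝ≥0) ≤ a (k + 1)) :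
    qvPath f a s - qvPath f a r = (f s - f u) ^ 2 - (f r - f u) ^ 2 := by
  rw [qvPath_eq f ha hu (hur.trans hrs) hs,
    qvPath_eq f ha hu hur (le_trans (by exact_mod_cast hrs) hs)]
  ring

lemma exists_qvPath_eq {𝓕 : Filtration ℝ≥0 mΩ} {σ : ℕ → Ω → WithTop ℝ≥0} (hσ : IsProper 𝓕 σ)
    (t : ℝ≥0) (ω : Ω) : ∃ N, ∀ s, s ≤ t → ∀ f : ℝ≥0 → ℝ, qvPath f (fun n => σ n ω) s =
      ∑ n ∈ Finset.range N, (f (cut (σ (n + 1) ω) s) - f (cut (σ n ω) s)) ^ 2 := by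
  obtain ⟨N, hN⟩ := hσ.exists_cut_eq t ω
  refine ⟨N, fun s hs f => tsum_eq_sum fun n hn => ?_⟩
  rw [hN n (by simpa using hn) s hs, sub_self, zero_pow two_ne_zero]

lemma continuousOn_qvPath {𝓕 : Filtration ℝ≥0 mΩ} {σ : ℕ → Ω → WithTop ℝ≥0} (hσ : IsProper 𝓕 σ)
    {t : ℝ≥0} {ω : Ω} {f : ℝ≥0 → ℝ} (hf : ContinuousOn f (Set.Iic t)) :
    ContinuousOn (qvPath f fun n => σ n ω) (Set.Iic t) := by
  obtain ⟨N, hN⟩ := exists_qvPath_eq hσ t ω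
  have hcut : ∀ a : WithTop ℝ≥0, ContinuousOn (fun s => f (cut a s)) (Set.Iic t) := fun a =>
    hf.comp (continuous_cut a).continuousOn fun s hs => (cut_le a s).trans hs
  refine ContinuousOn.congr ?_ fun s hs => hN s hs f
  exact continuousOn_finsetSum _ fun n _ => ((hcut _).sub (hcut _)).pow 2

lemma simpleQV_eq {𝓕 : Filtration ℝ≥0 mΩ} {σ : ℕ → Ω → WithTop ℝ≥0} (hσ : IsProper 𝓕 σ)
    {X : GenProcess Ω} {t : ℝ≥0} {ω : Ω} (hX : ∀ s, s ≤ t → X s ω ≠ ⊤ ∧ X s ω ≠ ⊥) {s : ℝ≥0}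
    (hs : s ≤ t) :
    simpleQV X σ s ω = (qvPath (fun s => (X s ω).toReal) (fun n => σ n ω) s : ℝ) := by
  obtain ⟨N, hN⟩ := hσ.exists_cut_eq t ω
  have h1 : ∀ n, (stoppedProcess X (σ (n + 1)) s ω - stoppedProcess X (σ n) s ω).abs ^ 2 =
      ENNReal.ofReal (((X (cut (σ (n + 1) ω) s) ω).toReal - (X (cut (σ n ω) s) ω).toReal) ^ 2) := by
    intro n
    have e1 := hX _ ((cut_le (σ (n + 1) ω) s).trans hs)
    have e2 := hX _ ((cut_le (σ n ω) s).trans hs)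
    simp only [stoppedProcess]
    rw [← cut, ← cut]
    conv_lhs => rw [← EReal.coe_toReal e1.1 e1.2, ← EReal.coe_toReal e2.1 e2.2]
    rw [← EReal.coe_sub, EReal.abs_def, ← ENNReal.ofReal_pow (abs_nonneg _), sq_abs]
  have hsum : Summable fun n => ((X (cut (σ (n + 1) ω) s) ω).toReal -
      (X (cut (σ n ω) s) ω).toReal) ^ 2 :=
    summable_of_ne_finset_zero (s := Finset.range N) fun n hn => by
      rw [hN n (by simpa using hn) s hs, sub_self, zero_pow two_ne_zero]
  have h0 : 0 ≤ qvPath (fun s => (X s ω).toReal) (fun n => σ n ω) s :=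
    tsum_nonneg fun _ => sq_nonneg _
  simp only [simpleQV, h1]
  rw [← ENNReal.ofReal_tsum_of_nonneg (fun _ => sq_nonneg _) hsum, EReal.coe_ennreal_ofReal,
    max_eq_left]
  · rfl
  · exact h0

lemma exists_le_lt {a : ℕ → WithTop ℝ≥0} (h0 : a 0 = 0) {u t : ℝ≥0} (hut : u ≤ t)
    (hfin : {n : ℕ | a n ≤ t}.Finite) : ∃ k, a k ≤ u ∧ (u : WithTop ℝ≥0) < a (k + 1) := by
  classical
  have hex : ∃ n, (u : WithTop ℝ≥0) < a n := by
    by_contra! h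
    refine Set.infinite_univ (hfin.subset fun n _ => ?_)
    exact (h n).trans (by exact_mod_cast hut)
  have hpos : Nat.find hex ≠ 0 := fun h => by
    have := Nat.find_spec hex
    rw [h, h0] at this
    exact not_lt_bot this
  obtain ⟨k, hk⟩ := Nat.exists_eq_succ_of_ne_zero hpos
  refine ⟨k, not_lt.1 (Nat.find_min hex (by omega)), ?_⟩
  have := Nat.find_spec hex
  rwa [hk] at this

omit mΩ in
lemma lastValue_eq {ξ : ℝ≥0 → Ω → ℝ} {τ σ : ℕ → Ω → WithTop ℝ≥0} {ω : Ω}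
    (hτ0 : τ 0 ω = 0) (hτ : Monotone fun n => τ n ω) (hσ : Monotone fun n => σ n ω)
    (hsucc : ∀ n k, τ n ω < σ k ω → τ (n + 1) ω ≤ σ k ω) {n : ℕ} {u : ℝ≥0} (hu : τ n ω = u)
    {k : ℕ} (hk : σ k ω ≤ u) (hk' : (u : WithTop ℝ≥0) < σ (k + 1) ω) :
    ∃ v : ℝ≥0, v ≤ u ∧ σ k ω = v ∧ lastValue ξ τ σ n ω = ξ v ω := by
  induction n generalizing u with
  | zero =>
    have hu0 : u = 0 := by rw [hτ0] at hu; exact_mod_cast hu.symm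
    refine ⟨0, bot_le, ?_, ?_⟩
    · rw [hu0] at hk; exact le_antisymm hk bot_le
    · simp only [lastValue, stoppedValue, hτ0]
      rfl
  | succ n ih =>
    by_cases hj : ∃ j, σ j ω = τ (n + 1) ω
    · have hlv : lastValue ξ τ σ (n + 1) ω = ξ u ω := by
        simp only [lastValue, if_pos hj, stoppedValue, hu]
        rfl
      obtain ⟨j, hj⟩ := hj
      have hjk : j ≤ k := by
        by_contra hlt
        have := hσ (show k + 1 ≤ j by omega)
        dsimp only at this
        rw [hj, hu] at this
        exact absurd hk' (not_lt.2 this)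
      refine ⟨u, le_rfl, le_antisymm hk ?_, hlv⟩
      rw [← hu, ← hj]
      exact hσ hjk
    · have h1 : σ k ω ≤ τ n ω := by
        by_contra hlt
        exact hj ⟨k, le_antisymm (hk.trans hu.ge) (hsucc n k (not_le.1 hlt))⟩
      have h2 : τ n ω ≤ u := (hτ (Nat.le_succ n)).trans hu.le
      obtain ⟨u', hu'⟩ := WithTop.ne_top_iff_exists.1 (ne_top_of_le_ne_top WithTop.coe_ne_top h2)
      have h3 : u' ≤ u := by rw [← hu'] at h2; exact_mod_cast h2
      obtain ⟨v, hv, hv', hv''⟩ :=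
        ih hu'.symm (hu' ▸ h1) (lt_of_le_of_lt (by exact_mod_cast h3) hk')
      exact ⟨v, hv.trans h3, hv', by simp only [lastValue, if_neg hj, hv'']⟩

lemma SimpleStrategy.integral_sub {𝓕 : Filtration ℝ≥0 mΩ} (G : SimpleStrategy 𝓕)
    (X : ℝ≥0 → Ω → ℝ) {n : ℕ} {u s : ℝ≥0} {ω : Ω} (hu : G.τ n ω = u) (hus : u ≤ s)
    (hs : (s : WithTop ℝ≥0) ≤ G.τ (n + 1) ω) :
    G.integral X s ω - G.integral X u ω = G.g n ω * (X s ω - X u ω) := by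
  have hus' : (u : WithTop ℝ≥0) ≤ s := by exact_mod_cast hus
  have h1 : cut (G.τ (n + 1) ω) s = s := cut_of_le hs
  have h2 : cut (G.τ n ω) s = u := by
    rw [← WithTop.coe_inj, coe_cut_of_ge (hu.le.trans hus'), hu]
  rw [← congrArg (fun r => G.integral X r ω) h1, ← congrArg (fun r => G.integral X r ω) h2,
    G.integral_cut, G.integral_cut, partialSum, partialSum, Finset.sum_range_succ, h1, h2]
  ring

/-- The inequality behind the comparison of quadratic variations. Here `K` and `Z` are integrals of
`f` along the times `a`, with positions `p` and `2 K p - 2 C f`. Since `p² ≤ C`, the squared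
increments of `K` are at most `C` times those of `f`, whence `Z ≥ K² + C (M² + 1 - f²)`. -/
lemma exists_ge_of_sq_ge {f K Z : ℝ≥0 → ℝ} {a : ℕ → WithTop ℝ≥0} (ha : Monotone a) (ha0 : a 0 = 0)
    {t : ℝ≥0} (hlt : ∃ n, (t : WithTop ℝ≥0) < a n) {b C M : ℝ} (hC : 0 ≤ C)
    (hf : ∀ s ≤ t, |f s| ≤ M) (hK0 : K 0 = 0) (hZ0 : Z 0 = C * (M ^ 2 + 1))
    (hstep : ∀ n, ∀ u ≤ t, a n = u → ∃ p : ℝ, p ^ 2 ≤ C ∧ ∀ s, u ≤ s → s ≤ t →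
      (s : WithTop ℝ≥0) ≤ a (n + 1) → K s - K u = p * (f s - f u) ∧
        (K u ^ 2 < b → Z s - Z u = (2 * K u * p - 2 * C * f u) * (f s - f u)))
    {s₀ : ℝ≥0} (hs₀ : s₀ ≤ t) (hb : b ≤ K s₀ ^ 2) :
    ∃ s ≤ t, (∀ r ≤ s, C ≤ Z r) ∧ b + C ≤ Z s := by
  have hbound : ∀ n, ∀ s ≤ t, (s : WithTop ℝ≥0) ≤ a n →
      (∀ j, ∀ u : ℝ≥0, a j = u → u < s → K u ^ 2 < b) →
      K s ^ 2 + C * (M ^ 2 + 1 - f s ^ 2) ≤ Z s := by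
    intro n
    induction n with
    | zero =>
      intro s hs hs0 _
      have : s = 0 := by
        rw [ha0] at hs0
        exact le_antisymm (by exact_mod_cast hs0) bot_le
      subst this
      rw [hK0, hZ0]
      nlinarith [mul_nonneg hC (sq_nonneg (f 0))]
    | succ n ih =>
      intro s hs hsn hgrid
      rcases le_or_gt (s : WithTop ℝ≥0) (a n) with h | h
      · exact ih s hs h hgrid
      · obtain ⟨u, hu⟩ := WithTop.ne_top_iff_exists.1 h.ne_top
        have hus : u < s := by rw [← hu] at h; exact_mod_cast h
        have hut := hus.le.trans hs
        obtain ⟨p, hp, hp'⟩ := hstep n u hut hu.symm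
        obtain ⟨h1, h2⟩ := hp' s hus.le hs hsn
        have h3 := h2 (hgrid n u hu.symm hus)
        have h4 := ih u hut hu.le fun j v hv hvu => hgrid j v hv (hvu.trans hus)
        have h5 : K s = K u + p * (f s - f u) := by linarith
        have h6 : Z s = Z u + (2 * K u * p - 2 * C * f u) * (f s - f u) := by linarith
        have h7 : p ^ 2 * (f s - f u) ^ 2 ≤ C * (f s - f u) ^ 2 :=
          mul_le_mul_of_nonneg_right hp (sq_nonneg _)
        rw [h5, h6]
        nlinarith
  obtain ⟨N, hN⟩ := hlt
  have hCf : ∀ s ≤ t, C ≤ C * (M ^ 2 + 1 - f s ^ 2) := fun s hs => by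
    have h1 : f s ^ 2 ≤ M ^ 2 := sq_le_sq' (abs_le.1 (hf s hs)).1 (abs_le.1 (hf s hs)).2
    nlinarith
  have hconc : ∀ s ≤ t, b ≤ K s ^ 2 → (∀ j, ∀ u : ℝ≥0, a j = u → u < s → K u ^ 2 < b) →
      ∃ s ≤ t, (∀ r ≤ s, C ≤ Z r) ∧ b + C ≤ Z s := by
    intro s hs hbs hgrid
    have hall : ∀ r ≤ s, K r ^ 2 + C ≤ Z r := fun r hr => by
      have hrt := hr.trans hs
      have hrN : (r : WithTop ℝ≥0) ≤ a N := le_trans (by exact_mod_cast hrt) hN.le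
      have := hbound N r hrt hrN fun j u hj hu => hgrid j u hj (hu.trans_le hr)
      linarith [hCf r hrt]
    exact ⟨s, hs, fun r hr => by nlinarith [hall r hr, sq_nonneg (K r)],
      by linarith [hall s le_rfl]⟩
  by_cases hex : ∃ j, ∃ u : ℝ≥0, a j = u ∧ u < s₀ ∧ b ≤ K u ^ 2
  · -- The bound fails at some time of the grid: take the first one.
    classical
    obtain ⟨u, hu, hus, hbu⟩ := Nat.find_spec hex
    refine hconc u (hus.le.trans hs₀) hbu fun j v hv hvu => ?_
    have hj : j < Nat.find hex := by
      by_contra hle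
      have := ha (not_lt.1 hle)
      rw [hu, hv] at this
      exact absurd hvu (not_lt.2 (by exact_mod_cast this))
    by_contra! hbv
    exact Nat.find_min hex hj ⟨v, hv, hvu.trans hus, hbv⟩
  · push Not at hex
    exact hconc s₀ hs₀ hb hex

/-- Only finitely many of the times `a` lie in `[0, t]`, and up to time `t` the trajectory `f`
oscillates by at most `δ` between consecutive ones. -/
def CoversUpTo (f : ℝ≥0 → ℝ) (a : ℕ → WithTop ℝ≥0) (δ : ℝ) (t : ℝ≥0) : Prop :=
  {n : ℕ | a n ≤ t}.Finite ∧ ∀ n, ∀ u v : ℝ≥0, u ≤ t → v ≤ t →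
    a n ≤ u → a n ≤ v → (u : WithTop ℝ≥0) ≤ a (n + 1) → (v : WithTop ℝ≥0) ≤ a (n + 1) →
    |f u - f v| ≤ δ

lemma FinelyCoversOn.coversUpTo {𝓕 : Filtration ℝ≥0 mΩ} {σ : ℕ → Ω → WithTop ℝ≥0}
    {X : GenProcess Ω} {δ : ℝ} {E : Set (ℝ≥0 × Ω)} (h : FinelyCoversOn 𝓕 σ X δ E) {t : ℝ≥0} {ω : Ω}
    (hE : (t, ω) ∈ E) (hX : ∀ s, s ≤ t → X s ω ≠ ⊤ ∧ X s ω ≠ ⊥) :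
    CoversUpTo (fun s => (X s ω).toReal) (fun n => σ n ω) δ t := by
  obtain ⟨h1, h2⟩ := h.2.2.2 t ω hE
  refine ⟨h1, fun n => ?_⟩
  have key : ∀ u v : ℝ≥0, u ≤ t → v ≤ t → σ n ω ≤ u → σ n ω ≤ v →
      (u : WithTop ℝ≥0) ≤ σ (n + 1) ω → (v : WithTop ℝ≥0) ≤ σ (n + 1) ω →
      (X u ω).toReal - (X v ω).toReal ≤ δ := by
    intro u v hu hv hnu hnv hu' hv'
    have mem : ∀ w : ℝ≥0, w ≤ t → σ n ω ≤ w → (w : WithTop ℝ≥0) ≤ σ (n + 1) ω →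
        (w : WithTop ℝ≥0) ∈ Set.Icc (min (σ n ω) t) (min (σ (n + 1) ω) t) := fun w h1 h2 h3 =>
      ⟨(min_le_left _ _).trans h2, le_min h3 (by exact_mod_cast h1)⟩
    have h3 : X u ω - X v ω ≤ δ := by
      refine le_trans (EReal.sub_le_sub ?_ ?_) (h2 n)
      · exact le_iSup₂ (f := fun (s : ℝ≥0) (_ : (s : WithTop ℝ≥0) ∈
          Set.Icc (min (σ n ω) t) (min (σ (n + 1) ω) t)) => X s ω) u (mem u hu hnu hu')
      · exact iInf₂_le (f := fun (s : ℝ≥0) (_ : (s : WithTop ℝ≥0) ∈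
          Set.Icc (min (σ n ω) t) (min (σ (n + 1) ω) t)) => X s ω) v (mem v hv hnv hv')
    rw [← EReal.coe_toReal (hX u hu).1 (hX u hu).2, ← EReal.coe_toReal (hX v hv).1 (hX v hv).2,
      ← EReal.coe_sub] at h3
    exact_mod_cast h3
  intro u v hu hv hnu hnv hu' hv'
  rw [abs_le]
  exact ⟨by linarith [key v u hv hu hnv hnu hv' hu'], key u v hu hv hnu hnv hu' hv'⟩

/-! ### Comparison of quadratic variations along different sequences -/

lemma isProper_merge {𝓕 : Filtration ℝ≥0 mΩ} {σ ρ : ℕ → Ω → WithTop ℝ≥0} (hσ : IsProper 𝓕 σ)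
    (hρ : IsProper 𝓕 ρ) : IsProper 𝓕 (mergeTimes (Sum.elim σ ρ)) :=
  isProper_mergeTimes (by rintro (i | i); exacts [hσ.1 i, hρ.1 i]) (finite_values_sumElim hσ hρ)

lemma exists_lastValue_eq {𝓕 : Filtration ℝ≥0 mΩ} {X : GenProcess Ω}
    {τ σ : ℕ → Ω → WithTop ℝ≥0} (hτ : IsProper 𝓕 τ) (hσ : IsProper 𝓕 σ) {ω : Ω} {t : ℝ≥0}
    (hX : IsRegularUpTo X t ω) (hsucc : ∀ n k, τ n ω < σ k ω → τ (n + 1) ω ≤ σ k ω) {δ : ℝ}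
    (hcov : CoversUpTo (fun s => (X s ω).toReal) (fun n => σ n ω) δ t) {n : ℕ} {u : ℝ≥0}
    (hut : u ≤ t) (hu : τ n ω = u) :
    |lastValue (leftVersion X) τ σ n ω - (X u ω).toReal| ≤ δ ∧
      ∀ s, u ≤ s → (s : WithTop ℝ≥0) ≤ τ (n + 1) ω →
        qvPath (fun s => (X s ω).toReal) (fun n => σ n ω) s -
            qvPath (fun s => (X s ω).toReal) (fun n => σ n ω) u =
          ((X s ω).toReal - lastValue (leftVersion X) τ σ n ω) ^ 2 -
            ((X u ω).toReal - lastValue (leftVersion X) τ σ n ω) ^ 2 := by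
  obtain ⟨k, hk, hk'⟩ := exists_le_lt (a := fun n => σ n ω) (hσ.2.2.1 ω) hut hcov.1
  obtain ⟨v, hvu, hv, hlv⟩ := lastValue_eq (ξ := leftVersion X) (hτ.2.2.1 ω) (hτ.mono ω)
    (hσ.mono ω) hsucc hu hk hk'
  have hvu' : (v : WithTop ℝ≥0) ≤ u := by exact_mod_cast hvu
  rw [hlv, leftVersion_eq hX (hvu.trans hut)]
  refine ⟨hcov.2 k v u (hvu.trans hut) hut hv.le hk (hvu'.trans hk'.le) hk'.le, fun s hs hs' => ?_⟩
  exact qvPath_sub _ (hσ.mono ω) hv hvu hs (hs'.trans (hsucc n (k + 1) (hu ▸ hk')))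

/-- If the quadratic variations of a trajectory along two fine covers come to differ by at least
`√(δ + δ')`, then `qvStrategy` multiplies its capital by a factor of order `(δ + δ')⁻¹`. -/
lemma exists_ge_of_qvPath_sub_sq_ge {𝓕 : Filtration ℝ≥0 mΩ} {X : GenProcess Ω} (hX : Adapted 𝓕 X)
    {σ ρ : ℕ → Ω → WithTop ℝ≥0} (hσ : IsProper 𝓕 σ) (hρ : IsProper 𝓕 ρ) {δ δ' M : ℝ} (hδ : 0 < δ)
    (hδ' : 0 < δ') {t : ℝ≥0} {ω : Ω} (hreg : IsRegularUpTo X t ω)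
    (hXM : ∀ s ≤ t, |(X s ω).toReal| ≤ M)
    (hcσ : CoversUpTo (fun s => (X s ω).toReal) (fun n => σ n ω) δ t)
    (hcρ : CoversUpTo (fun s => (X s ω).toReal) (fun n => ρ n ω) δ' t) {s₀ : ℝ≥0} (hs₀ : s₀ ≤ t)
    (hb : δ + δ' ≤ (qvPath (fun s => (X s ω).toReal) (fun n => σ n ω) s₀ -
      qvPath (fun s => (X s ω).toReal) (fun n => ρ n ω) s₀) ^ 2) :
    ∃ s ≤ t, (∀ r ≤ s, 4 * (δ + δ') ^ 2 ≤
        (qvStrategy (isStronglyProgressive_leftVersion hX) (isProper_merge hσ hρ) hσ.1 hρ.1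
          (4 * (δ + δ') ^ 2 * (M ^ 2 + 1)) (4 * (δ + δ') ^ 2)
          (4 * √(δ + δ') * (δ + δ') + 8 * (δ + δ') ^ 2 * M)).integral
            (fun t ω => (X t ω).toReal) r ω) ∧
      δ + δ' + 4 * (δ + δ') ^ 2 ≤
        (qvStrategy (isStronglyProgressive_leftVersion hX) (isProper_merge hσ hρ) hσ.1 hρ.1
          (4 * (δ + δ') ^ 2 * (M ^ 2 + 1)) (4 * (δ + δ') ^ 2)
          (4 * √(δ + δ') * (δ + δ') + 8 * (δ + δ') ^ 2 * M)).integral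
            (fun t ω => (X t ω).toReal) s ω := by
  set τ := mergeTimes (Sum.elim σ ρ) with hτdef
  have hτ : IsProper 𝓕 τ := isProper_merge hσ hρ
  set f : ℝ≥0 → ℝ := fun s => (X s ω).toReal with hf
  set η := δ + δ' with hη
  have hη0 : 0 < η := add_pos hδ hδ'
  set G := qvStrategy (isStronglyProgressive_leftVersion hX) (isProper_merge hσ hρ) hσ.1 hρ.1
    (4 * η ^ 2 * (M ^ 2 + 1)) (4 * η ^ 2) (4 * √η * η + 8 * η ^ 2 * M) with hG
  set lσ := fun n => lastValue (leftVersion X) τ σ n ω with hlσ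
  set lρ := fun n => lastValue (leftVersion X) τ ρ n ω with hlρ
  set K : ℝ≥0 → ℝ := fun s => qvPath f (fun n => σ n ω) s - qvPath f (fun n => ρ n ω) s with hK
  have hsσ : ∀ n k, τ n ω < σ k ω → τ (n + 1) ω ≤ σ k ω := fun n k h =>
    mergeTimes_succ_le (θ := Sum.elim σ ρ) (i := Sum.inl k) h
  have hsρ : ∀ n k, τ n ω < ρ k ω → τ (n + 1) ω ≤ ρ k ω := fun n k h =>
    mergeTimes_succ_le (θ := Sum.elim σ ρ) (i := Sum.inr k) h
  have hp : ∀ n, ∀ u ≤ t, τ n ω = u → |2 * (lρ n - lσ n)| ≤ 2 * η := by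
    intro n u hut hu
    have h1 := abs_le.1 (exists_lastValue_eq hτ hσ hreg hsσ hcσ hut hu).1
    have h2 := abs_le.1 (exists_lastValue_eq hτ hρ hreg hsρ hcρ hut hu).1
    rw [abs_le]
    constructor <;> simp only [hlσ, hlρ] <;> linarith
  have hKstep : ∀ n, ∀ u ≤ t, τ n ω = u → ∀ s, u ≤ s → (s : WithTop ℝ≥0) ≤ τ (n + 1) ω →
      K s - K u = 2 * (lρ n - lσ n) * (f s - f u) := by
    intro n u hut hu s hus hs
    have h1 := (exists_lastValue_eq hτ hσ hreg hsσ hcσ hut hu).2 s hus hs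
    have h2 := (exists_lastValue_eq hτ hρ hreg hsρ hcρ hut hu).2 s hus hs
    simp only [hK, hlσ, hlρ, hf] at h1 h2 ⊢
    linear_combination h1 - h2
  have hval : ∀ n, ∀ u ≤ t, τ n ω = u → stoppedValue (leftVersion X) (τ n) ω = f u := by
    intro n u hut hu
    rw [stoppedValue, hu]
    exact leftVersion_eq hreg hut
  have hqd : ∀ n, ∀ u ≤ t, τ n ω = u → qvDiff (leftVersion X) τ σ ρ n ω = K u := by
    intro n
    induction n with
    | zero =>
      intro u _ hu
      have : u = 0 := by rw [hτ.2.2.1 ω] at hu; exact_mod_cast hu.symm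
      simp [this, hK, qvDiff]
    | succ n ih =>
      intro u hut hu
      have h1 : τ n ω ≤ u := (hτ.2.1 n ω).trans hu.le
      obtain ⟨v, hv⟩ := WithTop.ne_top_iff_exists.1 (ne_top_of_le_ne_top WithTop.coe_ne_top h1)
      have hvu : v ≤ u := by rw [← hv] at h1; exact_mod_cast h1
      have hvt := hvu.trans hut
      simp only [qvDiff]
      rw [ih v hvt hv.symm, hval n v hvt hv.symm, hval (n + 1) u hut hu]
      linarith [hKstep n v hvt hv.symm u hvu hu.ge]
  have hlt : ∃ n, (t : WithTop ℝ≥0) < τ n ω :=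
    (eventually_lt_mergeTimes (finite_values_sumElim hσ hρ) ω t).exists
  refine exists_ge_of_sq_ge (f := f) (K := K) (Z := fun s => G.integral (fun t ω => (X t ω).toReal)
    s ω) (hτ.mono ω) (hτ.2.2.1 ω) hlt (by positivity) hXM (by simp [hK]) (G.integral_zero _ ω)
    (fun n u hut hu => ⟨2 * (lρ n - lσ n), ?_, fun s hus hst hs => ⟨?_, fun hKb => ?_⟩⟩) hs₀ hb
  · have := hp n u hut hu
    rw [← sq_abs]
    calc |2 * (lρ n - lσ n)| ^ 2 ≤ (2 * η) ^ 2 := pow_le_pow_left₀ (abs_nonneg _) this 2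
      _ = 4 * η ^ 2 := by ring
  · exact hKstep n u hut hu s hus hs
  · -- As long as `K² < η`, the truncation of the positions has no effect.
    have hKu : |K u| ≤ √η := Real.abs_le_sqrt hKb.le
    have hle : |2 * K u * (2 * (lρ n - lσ n)) - 2 * (4 * η ^ 2) * f u| ≤
        4 * √η * η + 8 * η ^ 2 * M := by
      refine (abs_sub _ _).trans (add_le_add ?_ ?_)
      · rw [abs_mul, abs_mul, abs_two]
        calc 2 * |K u| * |2 * (lρ n - lσ n)| ≤ 2 * √η * (2 * η) := by
              gcongr
              exact hp n u hut hu
          _ = 4 * √η * η := by ring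
      · rw [abs_mul, abs_of_nonneg (by positivity : (0 : ℝ) ≤ 2 * (4 * η ^ 2))]
        calc 2 * (4 * η ^ 2) * |f u| ≤ 2 * (4 * η ^ 2) * M := by
              gcongr
              exact hXM u hut
          _ = 8 * η ^ 2 * M := by ring
    have hg : G.g n ω = 2 * K u * (2 * (lρ n - lσ n)) - 2 * (4 * η ^ 2) * f u := by
      have hmem : ω ∈ ({ω | τ n ω = ⊤}ᶜ : Set Ω) :=
        fun h => WithTop.coe_ne_top (hu.symm.trans h)
      simp only [hG, qvStrategy]
      rw [Set.indicator_of_mem hmem, hqd n u hut hu, hval n u hut hu,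
        min_eq_right (abs_le.1 hle).2, max_eq_right (abs_le.1 hle).1]
    rw [← hg]
    exact G.integral_sub _ hu hus hs

lemma IsMartingale.adapted {𝔐 : MartingaleSpace Ω d} {X : GenProcess Ω}
    (hX : IsMartingale 𝔐 X) : Adapted 𝔐.𝓕 X := by
  cases hX with
  | capital Y hY => exact fun t => (hY.adapted t).coe_real_ereal
  | lim X' _ _ hZ _ _ => exact hZ

/-- Quadratic variations of a martingale along two sequences of fine covers with summable accuracies
are eventually close to each other. -/
lemma IsMartingale.eventually_qvPath_sub_sq_lt (hd : 1 ≤ d) {𝔐 : MartingaleSpace Ω d}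
    {X : GenProcess Ω} (hX : IsMartingale 𝔐 X) {δ δ' : ℕ → ℝ} (hδ : ∀ m, 0 < δ m)
    (hδ' : ∀ m, 0 < δ' m) (hs : Summable δ) (hs' : Summable δ') {σ ρ : ℕ → ℕ → Ω → WithTop ℝ≥0}
    (hσ : ∀ m, IsProper 𝔐.𝓕 (σ m)) (hρ : ∀ m, IsProper 𝔐.𝓕 (ρ m))
    (hcσ : ∀ m, FinelyCoversWIE 𝔐 (σ m) X (δ m)) (hcρ : ∀ m, FinelyCoversWIE 𝔐 (ρ m) X (δ' m)) :
    InstantlyEnforceable 𝔐 {p | ∀ᶠ m in atTop, ∀ s ≤ p.1,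
      (qvPath (fun s => (X s p.2).toReal) (fun n => σ m n p.2) s -
        qvPath (fun s => (X s p.2).toReal) (fun n => ρ m n p.2) s) ^ 2 < δ m + δ' m} := by
  have hη : ∀ m, 0 < δ m + δ' m := fun m => add_pos (hδ m) (hδ' m)
  choose Eσ hEσ hEσ' using hcσ
  choose Eρ hEρ hEρ' using hcρ
  let G : ℕ → ℕ → SimpleStrategy 𝔐.𝓕 := fun M m =>
    qvStrategy (isStronglyProgressive_leftVersion hX.adapted) (isProper_merge (hσ m) (hρ m))
      (hσ m).1 (hρ m).1 (4 * (δ m + δ' m) ^ 2 * ((M : ℝ) ^ 2 + 1)) (4 * (δ m + δ' m) ^ 2)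
      (4 * √(δ m + δ' m) * (δ m + δ' m) + 8 * (δ m + δ' m) ^ 2 * M)
  have hGc : ∀ M m, 0 < (G M m).c := fun M m => by
    have := hη m
    simp only [G, qvStrategy]
    positivity
  choose Y hY hY0 hYE using fun M m => hX.exists_superhedge hd (G M m) (hGc M m) (δ m + δ' m)
  have hYlt : ∀ M, InstantlyEnforceable 𝔐
      {p | ∀ᶠ m in atTop, Y M m p.1 p.2 < ((δ m + δ' m : ℝ) : EReal)} := by
    intro M
    refine InstantlyEnforceable.eventually_lt hd (hY M) (hGc M) hη ?_ (hY0 M)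
    refine ((hs.add hs').mul_left (4 * ((M : ℝ) ^ 2 + 1))).congr fun m => ?_
    simp only [G, qvStrategy]
    field_simp [(hη m).ne']
  refine ((((hX.isRegularUpTo hd).inter hd ((InstantlyEnforceable.iInter hd hEσ).inter hd
    (InstantlyEnforceable.iInter hd hEρ))).inter hd (InstantlyEnforceable.iInter hd hYlt)).inter hd
    (InstantlyEnforceable.iInter hd fun M => InstantlyEnforceable.iInter hd (hYE M))).mono ?_
  rintro ⟨t, ω⟩ ⟨⟨⟨hreg, h1, h2⟩, h3⟩, h4⟩
  simp only [Set.mem_iInter, Set.mem_ofPred_eq] at hreg h1 h2 h3 h4 ⊢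
  obtain ⟨B, hB⟩ := (isCompact_Icc (a := (0 : ℝ≥0)) (b := t)).exists_bound_of_continuousOn
    (hreg.2.mono Set.Icc_subset_Iic_self)
  obtain ⟨M, hM⟩ := exists_nat_ge B
  have hXM : ∀ s ≤ t, |(X s ω).toReal| ≤ M := fun s hs => (hB s ⟨bot_le, hs⟩).trans hM
  filter_upwards [h3 M] with m hm s hs
  by_contra! hge
  obtain ⟨s', hs', hpos, hbig⟩ := exists_ge_of_qvPath_sub_sq_ge hX.adapted (hσ m) (hρ m) (hδ m)
    (hδ' m) hreg hXM ((hEσ' m).coversUpTo (h1 m) hreg.1)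
    ((hEρ' m).coversUpTo (h2 m) hreg.1) hs hge
  have := h4 M m (4 * (δ m + δ' m) ^ 2) (by have := hη m; positivity) s' hs' hpos hbig
  exact absurd hm (not_lt.2 this)

/-! ### Freezing a process when it ceases to be continuous -/

open Classical in
/-- The value of `L` at the last of the times `i / 2ᵏ`, `i ≤ j`, at which `E` holds. -/
def frozenValue (L : ℝ≥0 → Ω → ℝ) (E : Set (ℝ≥0 × Ω)) (k : ℕ) : ℕ → Ω → ℝ
  | 0 => L 0
  | j + 1 => fun ω => if (((j + 1 : ℕ) : ℝ≥0) / 2 ^ k, ω) ∈ E then L (((j + 1 : ℕ) : ℝ≥0) / 2 ^ k) ω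
      else frozenValue L E k j ω

omit mΩ in
lemma frozenValue_of_mem {L : ℝ≥0 → Ω → ℝ} {E : Set (ℝ≥0 × Ω)} {k j : ℕ} {ω : Ω}
    (h : ((j : ℝ≥0) / 2 ^ k, ω) ∈ E) : frozenValue L E k j ω = L ((j : ℝ≥0) / 2 ^ k) ω := by
  cases j with
  | zero => simp [frozenValue]
  | succ j => simp only [frozenValue, if_pos h]

omit mΩ in
lemma frozenValue_add {L : ℝ≥0 → Ω → ℝ} {E : Set (ℝ≥0 × Ω)} {k j : ℕ} {ω : Ω}
    (h : ∀ i, j < i → ((i : ℝ≥0) / 2 ^ k, ω) ∉ E) (i : ℕ) :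
    frozenValue L E k (j + i) ω = frozenValue L E k j ω := by
  induction i with
  | zero => rfl
  | succ i ih =>
    have h1 := h (j + i + 1) (by omega)
    exact (if_neg h1).trans ih

/-- The process `L`, kept constant from the time on at which `E` fails. Its trajectories are
right-continuous even at the last time at which `E` holds, where `L` need not be. -/
def frozen (L : ℝ≥0 → Ω → ℝ) (E : Set (ℝ≥0 × Ω)) : ℝ≥0 → Ω → ℝ := fun t ω =>
  (limsup (fun k => (frozenValue L E k ⌊t * 2 ^ k⌋₊ ω : EReal)) atTop).toReal

lemma adapted_frozen {𝓕 : Filtration ℝ≥0 mΩ} {L : ℝ≥0 → Ω → ℝ} (hL : Adapted 𝓕 L)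
    {E : Set (ℝ≥0 × Ω)} (hE : ∀ t, MeasurableSet[𝓕 t] {ω | (t, ω) ∈ E}) :
    Adapted 𝓕 (frozen L E) := by
  intro t
  have key : ∀ k j : ℕ, (j : ℝ≥0) / 2 ^ k ≤ t → Measurable[𝓕 t] (frozenValue L E k j) := by
    intro k j
    induction j with
    | zero => exact fun _ => hL.measurable_le bot_le
    | succ j ih =>
      intro hj
      refine Measurable.ite (𝓕.mono hj _ (hE _)) (hL.measurable_le hj) (ih (le_trans ?_ hj))
      gcongr
      exact Nat.le_succ j
  let : MeasurableSpace Ω := 𝓕 t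
  exact measurable_ereal_toReal.comp (Measurable.limsup fun k =>
    (key k _ (gridFloor_le k t)).coe_real_ereal)

omit mΩ in
lemma frozen_eq_of_tendsto {L : ℝ≥0 → Ω → ℝ} {E : Set (ℝ≥0 × Ω)} {t : ℝ≥0} {ω : Ω} {y : ℝ}
    (h : Tendsto (fun k => frozenValue L E k ⌊t * 2 ^ k⌋₊ ω) atTop (𝓝 y)) :
    frozen L E t ω = y := by
  have h1 := ((continuous_coe_real_ereal.tendsto y).comp h).limsup_eq
  simp only [Function.comp_def] at h1
  rw [frozen, h1, EReal.toReal_coe]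

omit mΩ in
lemma tendsto_frozenValue {L : ℝ≥0 → Ω → ℝ} {E : Set (ℝ≥0 × Ω)}
    (hE : ∀ s t ω, s ≤ t → (t, ω) ∈ E → (s, ω) ∈ E)
    (hL : ∀ t ω, (t, ω) ∈ E → ContinuousOn (fun s => L s ω) (Set.Iic t))
    {t : ℝ≥0} {ω : Ω} (ht : (t, ω) ∈ E) :
    Tendsto (fun k => frozenValue L E k ⌊t * 2 ^ k⌋₊ ω) atTop (𝓝 (L t ω)) := by
  have h1 : ∀ k, frozenValue L E k ⌊t * 2 ^ k⌋₊ ω = L (gridFloor k t) ω := fun k =>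
    frozenValue_of_mem (hE _ _ ω (gridFloor_le k t) ht)
  simp only [h1]
  refine (hL t ω ht t (Set.mem_Iic.2 le_rfl)).tendsto.comp
    (tendsto_nhdsWithin_iff.2 ⟨tendsto_gridFloor t, ?_⟩)
  exact Eventually.of_forall fun k => gridFloor_le k t

omit mΩ in
lemma frozen_eq {L : ℝ≥0 → Ω → ℝ} {E : Set (ℝ≥0 × Ω)}
    (hE : ∀ s t ω, s ≤ t → (t, ω) ∈ E → (s, ω) ∈ E)
    (hL : ∀ t ω, (t, ω) ∈ E → ContinuousOn (fun s => L s ω) (Set.Iic t))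
    {t : ℝ≥0} {ω : Ω} (ht : (t, ω) ∈ E) {s : ℝ≥0} (hs : s ≤ t) :
    frozen L E s ω = L s ω :=
  frozen_eq_of_tendsto (tendsto_frozenValue hE hL (hE s t ω hs ht))

omit mΩ in
lemma continuousAt_frozen {L : ℝ≥0 → Ω → ℝ} {E : Set (ℝ≥0 × Ω)}
    (hE : ∀ s t ω, s ≤ t → (t, ω) ∈ E → (s, ω) ∈ E)
    (hL : ∀ t ω, (t, ω) ∈ E → ContinuousOn (fun s => L s ω) (Set.Iic t))
    {t : ℝ≥0} {ω : Ω} (ht : (t, ω) ∈ E) :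
    ContinuousAt (fun s => frozen L E s ω) t := by
  obtain ⟨t', ht', htE, hev⟩ : ∃ t', t ≤ t' ∧ (t', ω) ∈ E ∧
      ∀ᶠ s in 𝓝 t, frozen L E s ω = L (min s t') ω := by
    by_cases hlast : ∃ t', t < t' ∧ (t', ω) ∈ E
    · obtain ⟨t', htt', htE⟩ := hlast
      refine ⟨t', htt'.le, htE, ?_⟩
      filter_upwards [Iio_mem_nhds htt'] with s hs
      rw [min_eq_left (le_of_lt hs), frozen_eq hE hL htE (le_of_lt hs)]
    · -- Here `E` fails right after `t`, and the frozen process is constant from `t` on.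
      push Not at hlast
      refine ⟨t, le_rfl, ht, Eventually.of_forall fun s => ?_⟩
      rcases le_total s t with hs | hs
      · rw [min_eq_left hs, frozen_eq hE hL ht hs]
      · rw [min_eq_right hs]
        refine frozen_eq_of_tendsto ((tendsto_frozenValue hE hL ht).congr fun k => ?_)
        obtain ⟨i, hi⟩ := Nat.exists_eq_add_of_le
          (Nat.floor_mono (mul_le_mul_left hs (2 ^ k)) : ⌊t * 2 ^ k⌋₊ ≤ ⌊s * 2 ^ k⌋₊)
        rw [hi, frozenValue_add]
        intro j hj
        refine hlast _ ?_
        rw [lt_div_iff₀ (by positivity)]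
        exact (Nat.floor_lt zero_le).1 hj
  have hcont : Continuous fun s => L (min s t') ω :=
    (hL t' ω htE).comp_continuous (continuous_id.min continuous_const) fun s =>
      Set.mem_Iic.2 (min_le_right _ _)
  exact hcont.continuousAt.congr (hev.mono fun s hs => hs.symm)

/-- Up to the present, an enforceable property holds on a set of the current σ-field: this is what
the standing assumption on projections provides. -/
lemma measurableSet_section {𝔐 : MartingaleSpace Ω d} (hA : ProjectionAssumption 𝔐)
    {E : Set (ℝ≥0 × Ω)} (hE : InstantlyEnforceable 𝔐 E)
    (hmono : ∀ s t ω, s ≤ t → (t, ω) ∈ E → (s, ω) ∈ E) (t : ℝ≥0) :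
    MeasurableSet[𝔐.𝓕 t] {ω | (t, ω) ∈ E} := by
  have h := (hA t Eᶜ (by rwa [InstantlyBlockable, compl_compl])).compl
  convert! h using 1
  ext ω
  simp only [Set.mem_ofPred_eq, Set.mem_compl_iff, Set.mem_image, not_exists]
  constructor
  · rintro ht ⟨s, ω'⟩ ⟨⟨hs, hst, -⟩, rfl⟩
    exact hs (hmono s t ω' hst ht)
  · intro h
    by_contra ht
    exact h (t, ω) ⟨⟨ht, Set.mem_Iic.2 le_rfl, trivial⟩, rfl⟩

/-! ### The quadratic variation as a limit -/

lemma FinelyCoversWIE.mono {𝔐 : MartingaleSpace Ω d} {τ : ℕ → Ω → WithTop ℝ≥0} {X : GenProcess Ω}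
    {δ δ' : ℝ} (h : FinelyCoversWIE 𝔐 τ X δ) (hδ : δ ≤ δ') : FinelyCoversWIE 𝔐 τ X δ' := by
  obtain ⟨E, hE, h1, h2, h3, h4⟩ := h
  exact ⟨E, hE, h1, h2, h3, fun t ω hp => ⟨(h4 t ω hp).1, fun n =>
    ((h4 t ω hp).2 n).trans (by exact_mod_cast hδ)⟩⟩

lemma qvPath_congr {f g : ℝ≥0 → ℝ} {t : ℝ≥0} (h : ∀ s ≤ t, f s = g s) (a : ℕ → WithTop ℝ≥0)
    {s : ℝ≥0} (hs : s ≤ t) : qvPath f a s = qvPath g a s := by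
  refine tsum_congr fun n => ?_
  rw [h _ ((cut_le _ s).trans hs), h _ ((cut_le _ s).trans hs)]

lemma adapted_qvPath {𝓕 : Filtration ℝ≥0 mΩ} {ξ : ℝ≥0 → Ω → ℝ} (hξ : IsStronglyProgressive 𝓕 ξ)
    {σ : ℕ → Ω → WithTop ℝ≥0} (hσ : IsProper 𝓕 σ) :
    Adapted 𝓕 fun t ω => qvPath (fun s => ξ s ω) (fun n => σ n ω) t := by
  intro t
  have hcut : ∀ n, Measurable[𝓕 t] fun ω => ξ (cut (σ n ω) t) ω := fun n =>
    (hξ.stronglyAdapted_stoppedProcess (hσ.1 n) t).measurable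
  refine @measurable_of_tendsto_metrizable Ω ℝ (𝓕 t) _ _ _ _ (fun N ω => ∑ n ∈ Finset.range N,
    (ξ (cut (σ (n + 1) ω) t) ω - ξ (cut (σ n ω) t) ω) ^ 2) _
    (fun N => Finset.measurable_sum _ fun n _ => ((hcut (n + 1)).sub (hcut n)).pow_const 2) ?_
  rw [tendsto_pi_nhds]
  intro ω
  obtain ⟨N₀, hN⟩ := hσ.exists_cut_eq t ω
  refine (summable_of_ne_finset_zero (s := Finset.range N₀) fun n hn => ?_).hasSum.tendsto_sum_nat
  rw [hN n (by simpa using hn) t le_rfl, sub_self, zero_pow two_ne_zero]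

/-- The upper limit of the quadratic variations of `X` along the sequences `ρ k`. To be adapted, it
is formed with the progressively measurable version `leftVersion X` of `X`. -/
def limQV (X : GenProcess Ω) (ρ : ℕ → ℕ → Ω → WithTop ℝ≥0) : ℝ≥0 → Ω → ℝ := fun t ω =>
  (limsup (fun k => (qvPath (fun s => leftVersion X s ω) (fun n => ρ k n ω) t : EReal))
    atTop).toReal

lemma adapted_limQV {𝓕 : Filtration ℝ≥0 mΩ} {X : GenProcess Ω} (hX : Adapted 𝓕 X)
    {ρ : ℕ → ℕ → Ω → WithTop ℝ≥0} (hρ : ∀ k, IsProper 𝓕 (ρ k)) : Adapted 𝓕 (limQV X ρ) := by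
  intro t
  have h := fun k => adapted_qvPath (isStronglyProgressive_leftVersion hX) (hρ k) t
  let : MeasurableSpace Ω := 𝓕 t
  exact measurable_ereal_toReal.comp (Measurable.limsup fun k => (h k).coe_real_ereal)

/-- The times up to which `X` is regular and the quadratic variations along the sequences `ρ k`
converge at a geometric rate. -/
def qvConvergenceSet (X : GenProcess Ω) (ρ : ℕ → ℕ → Ω → WithTop ℝ≥0) : Set (ℝ≥0 × Ω) :=
  {p | IsRegularUpTo X p.1 p.2 ∧ ∀ᶠ k in atTop, ∀ s ≤ p.1,
    (qvPath (fun s => (X s p.2).toReal) (fun n => ρ k n p.2) s -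
      qvPath (fun s => (X s p.2).toReal) (fun n => ρ (k + 1) n p.2) s) ^ 2 <
        (1 / 4 : ℝ) ^ k + (1 / 4 : ℝ) ^ (k + 1)}

omit mΩ in
lemma qvConvergenceSet_mono {X : GenProcess Ω} {ρ : ℕ → ℕ → Ω → WithTop ℝ≥0} (s t : ℝ≥0) (ω : Ω)
    (hst : s ≤ t) (h : (t, ω) ∈ qvConvergenceSet X ρ) : (s, ω) ∈ qvConvergenceSet X ρ :=
  ⟨h.1.mono hst, h.2.mono fun _ hk r hr => hk r (hr.trans hst)⟩

omit mΩ in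
lemma eventually_qvPath_sub_limQV_le {X : GenProcess Ω} {ρ : ℕ → ℕ → Ω → WithTop ℝ≥0} {t : ℝ≥0}
    {ω : Ω} (h : (t, ω) ∈ qvConvergenceSet X ρ) {ε : ℝ} (hε : 0 < ε) :
    ∀ᶠ k in atTop, ∀ s ≤ t,
      |qvPath (fun s => (X s ω).toReal) (fun n => ρ k n ω) s - limQV X ρ s ω| ≤ ε := by
  obtain ⟨hreg, hconv⟩ := h
  obtain ⟨N, hN⟩ := eventually_atTop.1 hconv
  set F : ℕ → ℝ≥0 → ℝ := fun k s => qvPath (fun s => (X s ω).toReal) (fun n => ρ k n ω) s with hF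
  have hdist : ∀ s ≤ t, ∀ n, dist (F (N + n) s) (F (N + n + 1) s) ≤ 2 * (1 / 2) ^ n := by
    intro s hs n
    rw [Real.dist_eq]
    have h1 := hN (N + n) (by omega) s hs
    have h2 : (1 / 4 : ℝ) ^ (N + n) + (1 / 4 : ℝ) ^ (N + n + 1) ≤ (2 * (1 / 2) ^ n) ^ 2 := by
      have h3 : (1 / 4 : ℝ) ^ (N + n) ≤ (1 / 4) ^ n :=
        pow_le_pow_of_le_one (by norm_num) (by norm_num) (by omega)
      have h4 : ((1 / 2 : ℝ) ^ n) ^ 2 = (1 / 4) ^ n := by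
        rw [← pow_mul, mul_comm, pow_mul]; norm_num
      rw [mul_pow, h4, pow_succ]
      nlinarith [pow_nonneg (by norm_num : (0 : ℝ) ≤ 1 / 4) n]
    exact (abs_lt_of_sq_lt_sq (h1.trans_le h2) (by positivity)).le
  have htend : ∀ s ≤ t, Tendsto (fun k => F k s) atTop (𝓝 (limQV X ρ s ω)) := by
    intro s hs
    obtain ⟨y, hy⟩ := cauchySeq_tendsto_of_complete
      (cauchySeq_of_le_geometric (1 / 2 : ℝ) 2 (by norm_num) (hdist s hs))
    have hy' : Tendsto (fun k => F k s) atTop (𝓝 y) := by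
      rw [← tendsto_add_atTop_iff_nat N]
      simpa only [add_comm] using hy
    have h5 : limQV X ρ s ω = y := by
      have h6 : ∀ k, qvPath (fun s => leftVersion X s ω) (fun n => ρ k n ω) s = F k s := fun k =>
        qvPath_congr (fun r hr => leftVersion_eq hreg hr) _ hs
      have h7 := ((continuous_coe_real_ereal.tendsto y).comp hy').limsup_eq
      simp only [Function.comp_def] at h7
      simp only [limQV, h6, h7, EReal.toReal_coe]
    rwa [h5]
  have hsmall : Tendsto (fun n : ℕ => 2 * (1 / 2 : ℝ) ^ n / (1 - 1 / 2)) atTop (𝓝 0) := by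
    have := (tendsto_pow_atTop_nhds_zero_of_lt_one (by norm_num : (0 : ℝ) ≤ 1 / 2)
      (by norm_num)).const_mul 2 |>.div_const (1 - 1 / 2 : ℝ)
    simpa using this
  obtain ⟨n₀, hn₀⟩ := eventually_atTop.1 (hsmall.eventually_lt_const hε)
  filter_upwards [eventually_ge_atTop (N + n₀)] with k hk s hs
  obtain ⟨n, rfl⟩ := Nat.exists_eq_add_of_le (show N ≤ k by omega)
  have h7 : Tendsto (fun n => F (N + n) s) atTop (𝓝 (limQV X ρ s ω)) := by
    simpa only [add_comm] using (tendsto_add_atTop_iff_nat N).2 (htend s hs)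
  have h8 := dist_le_of_le_geometric_of_tendsto (1 / 2 : ℝ) 2 (by norm_num) (hdist s hs) h7 n
  rw [Real.dist_eq] at h8
  exact h8.trans (hn₀ n (by omega)).le

lemma continuousOn_limQV {𝓕 : Filtration ℝ≥0 mΩ} {X : GenProcess Ω} {ρ : ℕ → ℕ → Ω → WithTop ℝ≥0}
    (hρ : ∀ k, IsProper 𝓕 (ρ k)) (t : ℝ≥0) (ω : Ω) (h : (t, ω) ∈ qvConvergenceSet X ρ) :
    ContinuousOn (fun s => limQV X ρ s ω) (Set.Iic t) := by
  refine TendstoUniformlyOn.continuousOn (p := atTop)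
    (F := fun k => qvPath (fun s => (X s ω).toReal) (fun n => ρ k n ω)) ?_
    (Frequently.of_forall fun k => continuousOn_qvPath (hρ k) h.1.2)
  rw [Metric.tendstoUniformlyOn_iff]
  intro ε hε
  filter_upwards [eventually_qvPath_sub_limQV_le h (half_pos hε)] with k hk s hs
  rw [dist_comm, Real.dist_eq]
  linarith [hk s hs]

/-- Along covers of geometrically decreasing accuracy the quadratic variations converge w.i.e. -/
lemma IsMartingale.instantlyEnforceable_qvConvergenceSet (hd : 1 ≤ d)
    {𝔐 : MartingaleSpace Ω d} {X : GenProcess Ω} (hX : IsMartingale 𝔐 X) {ρ : ℕ → ℕ → Ω → WithTop ℝ≥0} (hρ : ∀ k, IsProper 𝔐.𝓕 (ρ k))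
    (hc : ∀ k, FinelyCoversWIE 𝔐 (ρ k) X ((1 / 4) ^ k)) :
    InstantlyEnforceable 𝔐 (qvConvergenceSet X ρ) := by
  have hs : Summable fun k : ℕ => (1 / 4 : ℝ) ^ k :=
    summable_geometric_of_lt_one (by norm_num) (by norm_num)
  exact (hX.isRegularUpTo hd).inter hd (hX.eventually_qvPath_sub_sq_lt hd (fun m => by positivity)
    (fun m => by positivity) hs ((summable_nat_add_iff 1).2 hs) hρ (fun m => hρ (m + 1)) hc
    fun m => hc (m + 1))

/-- The limit does not depend on the covers: the quadratic variations along any other covers of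
summable accuracies converge to it, too. -/
lemma IsMartingale.convergesWIE_frozen (hd : 1 ≤ d) {𝔐 : MartingaleSpace Ω d} {X : GenProcess Ω}
    (hX : IsMartingale 𝔐 X) {ρ : ℕ → ℕ → Ω → WithTop ℝ≥0} (hρ : ∀ k, IsProper 𝔐.𝓕 (ρ k))
    (hc : ∀ k, FinelyCoversWIE 𝔐 (ρ k) X ((1 / 4) ^ k)) {δ : ℕ → ℝ} (hδ : ∀ m, 0 < δ m)
    (hs : Summable δ) {σ : ℕ → ℕ → Ω → WithTop ℝ≥0} (hσ : ∀ m, IsProper 𝔐.𝓕 (σ m))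
    (hcσ : ∀ m, FinelyCoversWIE 𝔐 (σ m) X (δ m)) :
    ConvergesWIE 𝔐 (fun m => simpleQV X (σ m))
      (toGen (frozen (limQV X ρ) (qvConvergenceSet X ρ))) := by
  have hs' : Summable fun k : ℕ => (1 / 4 : ℝ) ^ k :=
    summable_geometric_of_lt_one (by norm_num) (by norm_num)
  refine ((hX.instantlyEnforceable_qvConvergenceSet hd hρ hc).inter hd
    (hX.eventually_qvPath_sub_sq_lt hd hδ (fun m => by positivity) hs hs' hσ hρ hcσ hc)).mono ?_
  rintro ⟨t, ω⟩ ⟨h1, h2⟩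
  refine tendsto_supDist_of_eventually fun ε hε => ?_
  have h3 : ∀ᶠ m in atTop, δ m + (1 / 4 : ℝ) ^ m < (ε / 2) ^ 2 :=
    (hs.add hs').tendsto_atTop_zero.eventually_lt_const (by positivity)
  filter_upwards [h2, h3, eventually_qvPath_sub_limQV_le h1 (half_pos hε)] with m hm hm' hm'' s hs
  refine ⟨_, _, simpleQV_eq (hσ m) h1.1.1 hs, rfl, ?_⟩
  rw [frozen_eq qvConvergenceSet_mono (continuousOn_limQV hρ) h1 hs]
  have h4 := abs_lt_of_sq_lt_sq ((hm s hs).trans hm') (by positivity)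
  refine (abs_sub_le _ (qvPath (fun s => (X s ω).toReal) (fun n => ρ m n ω) s) _).trans ?_
  linarith [hm'' s hs]

lemma ConvergesWIE.convergesWIEOn {𝔐 : MartingaleSpace Ω d} {Y : ℕ → GenProcess Ω}
    {Z : GenProcess Ω} (h : ConvergesWIE 𝔐 Y Z) (σ : Ω → WithTop ℝ≥0) :
    ConvergesWIEOn 𝔐 σ Y Z :=
  InstantlyEnforceable.mono h fun p hp =>
    tendsto_of_tendsto_of_tendsto_of_le_of_le tendsto_const_nhds hp (fun _ => bot_le)
      fun _ => supDist_mono (cut_le (σ p.2) p.1) p.2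

end ModelFree

end

open ModelFree in
theorem proposition103 {Ω : Type*} [MeasurableSpace Ω] {d : ℕ} (hd : 1 ≤ d)
    (𝔐 : ModelFree.MartingaleSpace Ω d) (hA : ModelFree.ProjectionAssumption 𝔐)
    (X : ModelFree.GenProcess Ω) (hX : ModelFree.IsMartingale 𝔐 X) :
    ∃ Q : ℝ≥0 → Ω → ℝ,
      Adapted 𝔐.𝓕 Q ∧ ModelFree.IsContinuousWIE 𝔐 (ModelFree.toGen Q) ∧
      ∀ (δ : ℕ → ℝ) (σ : ℕ → ℕ → Ω → WithTop ℝ≥0),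
        (∀ m, 0 < δ m) → Summable δ →
        (∀ m, ModelFree.IsProper 𝔐.𝓕 (σ m)) →
        (∀ m, ModelFree.FinelyCoversWIE 𝔐 (σ m) X (δ m)) →
        (∀ M : ℝ, 0 < M →
          ModelFree.ConvergesWIEOn 𝔐 (ModelFree.hitLevel X M)
            (fun m => ModelFree.simpleQV X (σ m)) (ModelFree.toGen Q)) ∧
        ModelFree.ConvergesWIE 𝔐 (fun m => ModelFree.simpleQV X (σ m)) (ModelFree.toGen Q) := by
  -- Unless there are fine covers of every accuracy, no sequence of covers has summable accuracies.
  by_cases hcov : ∀ k : ℕ, ∃ ρ : ℕ → Ω → WithTop ℝ≥0,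
      IsProper 𝔐.𝓕 ρ ∧ FinelyCoversWIE 𝔐 ρ X ((1 / 4) ^ k)
  · choose ρ hρ hc using hcov
    have hE := hX.instantlyEnforceable_qvConvergenceSet hd hρ hc
    refine ⟨frozen (limQV X ρ) (qvConvergenceSet X ρ),
      adapted_frozen (adapted_limQV hX.adapted hρ)
        (measurableSet_section hA hE qvConvergenceSet_mono),
      hE.mono fun p hp => ⟨⟨EReal.coe_ne_top _, EReal.coe_ne_bot _⟩, ?_⟩,
      fun δ σ hδ hs hσ hcσ => ?_⟩
    · exact continuous_coe_real_ereal.continuousAt.comp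
        (continuousAt_frozen qvConvergenceSet_mono (continuousOn_limQV hρ) hp)
    · have h := hX.convergesWIE_frozen hd hρ hc hδ hs hσ hcσ
      exact ⟨fun M _ => h.convergesWIEOn _, h⟩
  · refine ⟨fun _ _ => 0, fun _ => measurable_const, ?_, fun δ σ hδ hs hσ hcσ => ?_⟩
    · exact (InstantlyEnforceable.univ hd 𝔐).mono fun p _ =>
        ⟨⟨EReal.coe_ne_top _, EReal.coe_ne_bot _⟩, continuousAt_const⟩
    · refine absurd (fun k => ?_) hcov
      obtain ⟨m, hm⟩ := (hs.tendsto_atTop_zero.eventually_lt_const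
        (show (0 : ℝ) < (1 / 4) ^ k by positivity)).exists
      exact ⟨σ m, hσ m, (hcσ m).mono hm.le⟩
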